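/- Let $S_n$ be the symmetric group on $[n]=\{1,\dots,n\}$, and let $\mathbb{E}$ denote expectation with respect to a uniformly random permutation $\pi\in S_n$. For $i,j\in[n]$ let $x_{i,j}\colon S_n\to\{0,1\}$ be the indicator function of the set of permutations sending $i$ to $j$. A function $f\colon S_n\to\mathbb{R}$ is *linear* if $f=\sum_{i=1}^n\sum_{j=1}^n c_{i,j}x_{i,j}$ for some $c_{i,j}\in\mathbb{R}$; it is *$\epsilon$-close to Boolean* if $\mathbb{E}[\operatorname{dist}(f,\{0,1\})^2]\le\epsilon$, where $\operatorname{dist}(y,\{0,1\})=\min(|y|,|y-1|)$. A *dictator* is a function $g\colon S_n\to\{0,1\}$ such that either $g(\pi)$ depends only on $\pi(i)$ for some $i\in[n]$, or $g(\pi)$ depends only on $\pi^{-1}(j)$ for some $j\in[n]$. There exist absolute constants $K>0$ and $C>0$ such that the following holds for all $n$, all $f\colon S_n\to\mathbb{R}$, all real $\epsilon\ge 0$ and all real $\delta>0$. If $f$ is linear and $\epsilon$-close to Boolean, and if $\delta\le\mathbb{E}[f]\le 1-\delta$ where $\delta\ge K\sqrt{\epsilon}$, then there is a dictator $g$ such that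 \[ \mathbb{E}[(f-g)^2]\le C\,\frac{\epsilon}{\delta}. \] -/

import Mathlib

open scoped BigOperators

noncomputable section

namespace SymmetricFKN

/-- The indicator `x_{i,j}` of the coset of all permutations sending `i` to `j`. -/
def cosetIndicator {n : ℕ} (i j : Fin n) (π : Equiv.Perm (Fin n)) : ℝ :=
  if π i = j then 1 else 0

/-- A function on `S_n` is linear if it is a linear combination of the `x_{i,j}`. -/
def IsLinear {n : ℕ} (f : Equiv.Perm (Fin n) → ℝ) : Prop :=
  ∃ c : Fin n → Fin n → ℝ, ∀ π, f π = ∑ i, ∑ j, c i j * cosetIndicator i j π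

/-- The expectation of `f` with respect to a uniformly random permutation. -/
def mean {n : ℕ} (f : Equiv.Perm (Fin n) → ℝ) : ℝ :=
  𝔼 π, f π

/-- The distance of a real number from the set `{0, 1}`. -/
def distBool (x : ℝ) : ℝ :=
  min |x - 0| |x - 1|

/-- `f` is `ε`-close to Boolean in `L₂`: `E[dist(f, {0,1})²] ≤ ε`. -/
def IsCloseToBoolean {n : ℕ} (ε : ℝ) (f : Equiv.Perm (Fin n) → ℝ) : Prop :=
  mean (fun π => distBool (f π) ^ 2) ≤ ε

/-- `f` is `ε`-close to `g` in `L₂`: `E[(f - g)²] ≤ ε`. -/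
def IsClose {n : ℕ} (ε : ℝ) (f g : Equiv.Perm (Fin n) → ℝ) : Prop :=
  mean (fun π => (f π - g π) ^ 2) ≤ ε

/-- A dictator is a `{0,1}`-valued function `g` such that `g π` depends only on `π i` for
some `i`, or only on `π⁻¹ j` for some `j`. -/
def IsDictator {n : ℕ} (g : Equiv.Perm (Fin n) → ℝ) : Prop :=
  (∀ π, g π = 0 ∨ g π = 1) ∧
    ((∃ i : Fin n, ∀ π σ : Equiv.Perm (Fin n), π i = σ i → g π = g σ) ∨
      (∃ j : Fin n, ∀ π σ : Equiv.Perm (Fin n), π⁻¹ j = σ⁻¹ j → g π = g σ))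

end SymmetricFKN

end

open scoped BigOperators

noncomputable section

namespace SymmetricFKN

/-! A uniform permutation can be written `σ * pairSwap r * ρ⁻¹` with `ρ`, `σ` uniform permutations
and `r` a uniform string of `n / 2` signs. For fixed `ρ`, `σ` a linear function is affine in the
signs, and its coefficients are half the alternating sums ("rectangles") of the matrix over paired
rows and columns. The FKN theorem on the cube makes all but one coefficient small, and flipping a
single sign shows that every rectangle is close to an integer. Row and column potentials change a
linear function only by a constant, so the rectangles against a well-chosen base cell can serve as
coefficients; rounding them gives an integer linear function O(ε)-close to `f`
(`exists_int_lin_close`).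

For an integer matrix, let N be the number of nonzero rectangles in a random family of disjoint
ones. N exceeds 1 by at most a multiple of the local distance to Boolean, and comparing factorial
moments gives E[N(N-1)] = O(ε) (`mul_sum_rectInd₂_le`). In the representative with fewest nonzero
entries, every nonzero entry is a corner of a positive proportion of nonzero rectangles. Hence only
O(ε n²) pairs of nonzero entries lie in different rows and columns (`exists_normalisation`). Since
the mean stays δ away from 0 and 1, there are at least δn/2 nonzero entries (`mul_le_two_mul_card`),
so all but O((ε/δ) n) of them lie on one line (`exists_line`). A random permutation meets an entry
off that line with probability O(ε/δ); keeping the line only and clamping to {0,1} gives the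
dictator.

For n < 64 the bound on ε forces the integer function to be exactly Boolean, and integral duality
for the assignment problem identifies it as a dictator (`isDictator_of_boolean`). -/

open Finset

/-! ### The FKN theorem on the cube -/

section Cube

variable {ι : Type*} [DecidableEq ι]

/-- The sign `±1` encoded by a bit. -/
def bitSign (b : Bool) : ℝ := if b then 1 else -1

lemma bitSign_not (b : Bool) : bitSign (!b) = -bitSign b := by
  cases b <;> simp [bitSign]

lemma bitSign_sq (b : Bool) : bitSign b ^ 2 = 1 := by
  cases b <;> simp [bitSign]

/-- The Rademacher sum over the coordinates in `T`. -/
def radSum (c : ι → ℝ) (T : Finset ι) (r : ι → Bool) : ℝ := ∑ k ∈ T, c k * bitSign (r k)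

/-- Negate all bits in `T`. -/
def flipBits (T : Finset ι) : (ι → Bool) ≃ (ι → Bool) :=
  Function.Involutive.toPerm (fun r k => if k ∈ T then !r k else r k) (by
    intro r; funext k; by_cases h : k ∈ T <;> simp [h])

lemma flipBits_apply (T : Finset ι) (r : ι → Bool) (k : ι) :
    flipBits T r k = if k ∈ T then !r k else r k := rfl

lemma radSum_flipBits_of_subset (c : ι → ℝ) {T U : Finset ι} (h : T ⊆ U) (r : ι → Bool) :
    radSum c T (flipBits U r) = -radSum c T r := by
  unfold radSum
  rw [← Finset.sum_neg_distrib]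
  refine Finset.sum_congr rfl fun k hk => ?_
  rw [flipBits_apply, if_pos (h hk), bitSign_not]; ring

lemma radSum_flipBits_of_disjoint (c : ι → ℝ) {T U : Finset ι} (h : Disjoint T U) (r : ι → Bool) :
    radSum c T (flipBits U r) = radSum c T r := by
  unfold radSum
  refine Finset.sum_congr rfl fun k hk => ?_
  rw [flipBits_apply, if_neg (Finset.disjoint_left.mp h hk)]

variable [Fintype ι]

lemma expect_flipBits (T : Finset ι) (F : (ι → Bool) → ℝ) :
    𝔼 r, F (flipBits T r) = 𝔼 r, F r :=
  Fintype.expect_equiv (flipBits T) _ _ fun _ => rfl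

lemma expect_odd_mul_bitSign (c : ι → ℝ) {T : Finset ι} {k : ι} (hk : k ∉ T) (φ : ℝ → ℝ) :
    𝔼 r : ι → Bool, φ (radSum c T r) * bitSign (r k) = 0 := by
  have h := expect_flipBits {k} fun r : ι → Bool => φ (radSum c T r) * bitSign (r k)
  have h2 : ∀ r : ι → Bool, φ (radSum c T (flipBits {k} r)) * bitSign (flipBits {k} r k)
      = -(φ (radSum c T r) * bitSign (r k)) := by
    intro r
    rw [radSum_flipBits_of_disjoint c (by simpa using hk), flipBits_apply,
      if_pos (by simp), bitSign_not]
    ring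
  simp only [h2, Finset.expect_neg_distrib] at h
  linarith

lemma expect_radSum_sq (c : ι → ℝ) (T : Finset ι) :
    𝔼 r : ι → Bool, radSum c T r ^ 2 = ∑ k ∈ T, c k ^ 2 := by
  induction T using Finset.induction_on with
  | empty => simp [radSum]
  | insert k T hk ih =>
    have h : ∀ r : ι → Bool, radSum c (insert k T) r ^ 2
        = radSum c T r ^ 2 + 2 * c k * (radSum c T r * bitSign (r k)) + c k ^ 2 := by
      intro r
      have : radSum c (insert k T) r = c k * bitSign (r k) + radSum c T r := by
        unfold radSum; rw [Finset.sum_insert hk]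
      rw [this]; linear_combination c k ^ 2 * bitSign_sq (r k)
    have h0 := expect_odd_mul_bitSign c hk fun x => x
    simp only [h, Finset.expect_add_distrib, ← Finset.mul_expect, ih, h0,
      Fintype.expect_const, Finset.sum_insert hk]
    ring

/-- Odd powers of a fresh sign average to zero; what is left, `6 * c k ^ 2` times the variance plus
`c k ^ 4`, fits in the growth of three times the squared variance. -/
lemma expect_radSum_pow_four_le (c : ι → ℝ) (T : Finset ι) :
    𝔼 r : ι → Bool, radSum c T r ^ 4 ≤ 3 * (∑ k ∈ T, c k ^ 2) ^ 2 := by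
  induction T using Finset.induction_on with
  | empty => simp [radSum]
  | insert k T hk ih =>
    have h : ∀ r : ι → Bool, radSum c (insert k T) r ^ 4
        = radSum c T r ^ 4 + 4 * c k * (radSum c T r ^ 3 * bitSign (r k))
          + 6 * c k ^ 2 * radSum c T r ^ 2 + 4 * c k ^ 3 * (radSum c T r * bitSign (r k))
          + c k ^ 4 := by
      intro r
      have : radSum c (insert k T) r = c k * bitSign (r k) + radSum c T r := by
        unfold radSum; rw [Finset.sum_insert hk]
      rw [this]
      linear_combination (6 * c k ^ 2 * radSum c T r ^ 2
        + 4 * c k ^ 3 * (radSum c T r * bitSign (r k))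
        + c k ^ 4 * (bitSign (r k) ^ 2 + 1)) * bitSign_sq (r k)
    have h0 := expect_odd_mul_bitSign c hk fun x => x
    have h1 := expect_odd_mul_bitSign c hk fun x => x ^ 3
    simp only [h, Finset.expect_add_distrib, ← Finset.mul_expect, expect_radSum_sq, h0, h1,
      Fintype.expect_const, Finset.sum_insert hk]
    nlinarith [sq_nonneg (c k ^ 2)]

/-- A Paley–Zygmund bound: min(x, 1) ≥ x - x²/4, and the normalised square has mean 1 and second
moment at most 3, leaving 1 - 3/4. -/
lemma quarter_le_expect_min_radSum (c : ι → ℝ) (T : Finset ι) {V : ℝ} (hV : 0 < V)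
    (h : ∑ k ∈ T, c k ^ 2 = V) :
    1 / 4 ≤ 𝔼 r : ι → Bool, min (radSum c T r ^ 2 / V) 1 := by
  have hpt : ∀ x : ℝ, x - x ^ 2 / 4 ≤ min x 1 := fun x => by
    refine le_min ?_ ?_ <;> nlinarith [sq_nonneg x, sq_nonneg (x - 2)]
  have h2 := expect_radSum_sq c T
  have h4 := expect_radSum_pow_four_le c T
  rw [h] at h2 h4
  calc (1 : ℝ) / 4 ≤ V / V - (3 * V ^ 2) / V ^ 2 / 4 := by
        field_simp; norm_num
    _ ≤ (𝔼 r : ι → Bool, radSum c T r ^ 2) / V - (𝔼 r : ι → Bool, radSum c T r ^ 4) / V ^ 2 / 4 := by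
        rw [h2]; gcongr
    _ = 𝔼 r : ι → Bool, (radSum c T r ^ 2 / V - (radSum c T r ^ 2 / V) ^ 2 / 4) := by
        rw [Finset.expect_sub_distrib, Finset.expect_div, Finset.expect_div, Finset.expect_div]
        congr 2; funext r; ring
    _ ≤ _ := Finset.expect_le_expect fun r _ => hpt _

/-- Take the bits in `T` from the first point and the others from the second. -/
def mixBits (T : Finset ι) (r r' : ι → Bool) : ι → Bool := fun k => if k ∈ T then r k else r' k

/-- Exchanging the bits outside `T` between two points preserves the measure on pairs. This is the
form in which independence of the sums over `T` and `Tᶜ` is used. -/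
lemma expect_mixBits (T : Finset ι) (F : (ι → Bool) → ℝ) :
    𝔼 p : (ι → Bool) × (ι → Bool), F (mixBits T p.1 p.2) = 𝔼 r, F r := by
  let e : (ι → Bool) × (ι → Bool) ≃ (ι → Bool) × (ι → Bool) :=
    Function.Involutive.toPerm (fun p => (mixBits T p.1 p.2, mixBits T p.2 p.1)) (by
      rintro ⟨r, r'⟩
      ext k <;> by_cases h : k ∈ T <;> simp [mixBits, h])
  have h1 : 𝔼 p : (ι → Bool) × (ι → Bool), F (mixBits T p.1 p.2)
      = 𝔼 p : (ι → Bool) × (ι → Bool), F p.1 :=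
    Fintype.expect_equiv e _ _ fun _ => rfl
  rw [h1, ← Finset.univ_product_univ, Finset.expect_product]
  simp

lemma distBool_nonneg (x : ℝ) : 0 ≤ distBool x := le_min (abs_nonneg _) (abs_nonneg _)

lemma distBool_eq_or (x : ℝ) : distBool x = |x| ∨ distBool x = |x - 1| := by
  unfold distBool
  rcases min_choice |x - 0| |x - 1| with h | h
  · left; rw [h, sub_zero]
  · exact Or.inr h

lemma distBool_le_abs (x : ℝ) : distBool x ≤ |x| := by
  unfold distBool; simp

lemma distBool_le_abs_sub_one (x : ℝ) : distBool x ≤ |x - 1| := min_le_right _ _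

lemma distBool_le_add (x y : ℝ) : distBool x ≤ |x - y| + distBool y := by
  rcases distBool_eq_or y with h | h <;> rw [h]
  · have := distBool_le_abs x
    have := abs_add_le (x - y) y
    simp only [sub_add_cancel] at this
    linarith
  · have := distBool_le_abs_sub_one x
    have := abs_add_le (x - y) (y - 1)
    simp only [sub_add_sub_cancel] at this
    linarith

lemma distBool_sq_le (x y : ℝ) : distBool x ^ 2 ≤ 2 * (x - y) ^ 2 + 2 * distBool y ^ 2 := by
  have h := distBool_le_add x y
  have h0 := distBool_nonneg x
  nlinarith [sq_abs (x - y), sq_nonneg (|x - y| - distBool y)]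

/-- If two values differing by 2x or by 2y are near the same point of {0,1}, then |x| ≤ t or |y| ≤
t. Otherwise the points alternate: one diagonal puts 2d within 2t of 0, the other within 2t of 2, so
t ≥ 1/2 and |2x| ≤ 1 + 2t ≤ 4t. This is the source of the factor 2. -/
lemma abs_le_or_abs_le_of_four_distBool_le {d x y t : ℝ} (h1 : distBool (d + x + y) ≤ t)
    (h2 : distBool (d + x - y) ≤ t) (h3 : distBool (d - x + y) ≤ t)
    (h4 : distBool (d - x - y) ≤ t) : |x| ≤ 2 * t ∨ |y| ≤ 2 * t := by
  simp only [abs_le]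
  rcases distBool_eq_or (d + x + y) with e1 | e1 <;> rcases distBool_eq_or (d + x - y) with e2 | e2 <;>
  rcases distBool_eq_or (d - x + y) with e3 | e3 <;> rcases distBool_eq_or (d - x - y) with e4 | e4 <;>
  rw [e1] at h1 <;> rw [e2] at h2 <;> rw [e3] at h3 <;> rw [e4] at h4 <;>
  rw [abs_le] at h1 h2 h3 h4 <;> obtain ⟨a1, b1⟩ := h1 <;> obtain ⟨a2, b2⟩ := h2 <;>
  obtain ⟨a3, b3⟩ := h3 <;> obtain ⟨a4, b4⟩ := h4 <;>
  first
    | exact Or.inl ⟨by linarith, by linarith⟩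
    | exact Or.inr ⟨by linarith, by linarith⟩

lemma min_sq_le_of_four_distBool (d x y : ℝ) :
    min (x ^ 2) (y ^ 2) ≤ 4 * (distBool (d + x + y) ^ 2 + distBool (d + x - y) ^ 2
      + distBool (d - x + y) ^ 2 + distBool (d - x - y) ^ 2) := by
  set a := distBool (d + x + y) with ha
  set b := distBool (d + x - y) with hb
  set c := distBool (d - x + y) with hc
  set e := distBool (d - x - y) with he
  set t := Real.sqrt (a ^ 2 + b ^ 2 + c ^ 2 + e ^ 2) with ht
  have hs : t ^ 2 = a ^ 2 + b ^ 2 + c ^ 2 + e ^ 2 := Real.sq_sqrt (by positivity)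
  have le_t : ∀ z, z ^ 2 ≤ a ^ 2 + b ^ 2 + c ^ 2 + e ^ 2 → z ≤ t := fun z hz =>
    Real.le_sqrt_of_sq_le hz
  have key := abs_le_or_abs_le_of_four_distBool_le (d := d) (x := x) (y := y) (t := t)
    (le_t _ (by nlinarith [sq_nonneg b, sq_nonneg c, sq_nonneg e]))
    (le_t _ (by nlinarith [sq_nonneg a, sq_nonneg c, sq_nonneg e]))
    (le_t _ (by nlinarith [sq_nonneg b, sq_nonneg a, sq_nonneg e]))
    (le_t _ (by nlinarith [sq_nonneg b, sq_nonneg c, sq_nonneg a]))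
  have fin : ∀ z, |z| ≤ 2 * t → z ^ 2 ≤ 4 * (a ^ 2 + b ^ 2 + c ^ 2 + e ^ 2) := fun z hz => by
    rw [← hs, ← sq_abs]; nlinarith [abs_nonneg z]
  rcases key with h | h
  · exact (min_le_left _ _).trans (fin _ h)
  · exact (min_le_right _ _).trans (fin _ h)

/-- Negating the signs in `T`, in `Tᶜ` or in both preserves the measure and produces the four
combinations d ± x ± y, so each of them has the same mean squared distance. -/
lemma expect_min_radSum_le (d : ℝ) (c : ι → ℝ) (T : Finset ι) :
    𝔼 r : ι → Bool, min (radSum c T r ^ 2) (radSum c Tᶜ r ^ 2)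
      ≤ 16 * 𝔼 r : ι → Bool, distBool (d + radSum c univ r) ^ 2 := by
  have hsplit : ∀ r : ι → Bool, radSum c univ r = radSum c T r + radSum c Tᶜ r := fun r =>
    (Finset.sum_add_sum_compl T _).symm
  set F : (ι → Bool) → ℝ := fun r => distBool (d + radSum c univ r) ^ 2 with hF
  have hdis : Disjoint T Tᶜ := disjoint_compl_right
  have hpt : ∀ r : ι → Bool, min (radSum c T r ^ 2) (radSum c Tᶜ r ^ 2)
      ≤ 4 * (F r + F (flipBits Tᶜ r) + F (flipBits T r) + F (flipBits univ r)) := by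
    intro r
    have h := min_sq_le_of_four_distBool d (radSum c T r) (radSum c Tᶜ r)
    simp only [hF, hsplit, radSum_flipBits_of_subset c (Finset.subset_univ _),
      radSum_flipBits_of_subset c (Finset.Subset.refl _),
      radSum_flipBits_of_disjoint c hdis, radSum_flipBits_of_disjoint c hdis.symm]
    convert h using 6 <;> ring_nf
  calc _ ≤ 𝔼 r : ι → Bool, 4 * (F r + F (flipBits Tᶜ r) + F (flipBits T r) + F (flipBits univ r)) :=
        Finset.expect_le_expect fun r _ => hpt r
    _ = _ := by
        rw [← Finset.mul_expect, Finset.expect_add_distrib, Finset.expect_add_distrib,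
          Finset.expect_add_distrib, expect_flipBits, expect_flipBits, expect_flipBits]
        ring

/-- The two sums are independent and each is of the order of its standard deviation with constant
probability. So the mean of the smaller square is at least 1/16 of the smaller variance, and it is
at most 16 times the distance: 256 = 16 · 16. -/
lemma min_variance_radSum_le (d : ℝ) (c : ι → ℝ) (T : Finset ι) :
    min (∑ k ∈ T, c k ^ 2) (∑ k ∈ Tᶜ, c k ^ 2)
      ≤ 256 * 𝔼 r : ι → Bool, distBool (d + radSum c univ r) ^ 2 := by
  have hmain := expect_min_radSum_le d c T
  set V := ∑ k ∈ T, c k ^ 2 with hV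
  set W := ∑ k ∈ Tᶜ, c k ^ 2 with hW
  have hη : 0 ≤ 𝔼 r : ι → Bool, distBool (d + radSum c univ r) ^ 2 :=
    Finset.expect_nonneg fun _ _ => sq_nonneg _
  have hV0 : 0 ≤ V := Finset.sum_nonneg fun _ _ => sq_nonneg _
  have hW0 : 0 ≤ W := Finset.sum_nonneg fun _ _ => sq_nonneg _
  rcases hV0.eq_or_lt with hV1 | hV1
  · rw [← hV1]; exact (min_le_left _ _).trans (by positivity)
  rcases hW0.eq_or_lt with hW1 | hW1
  · rw [← hW1]; exact (min_le_right _ _).trans (by positivity)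
  set u := min V W with hu
  have hu0 : 0 < u := lt_min hV1 hW1
  have hX := quarter_le_expect_min_radSum c T hV1 rfl
  have hY := quarter_le_expect_min_radSum c Tᶜ hW1 rfl
  have hT : ∀ r r' : ι → Bool, radSum c T (mixBits T r r') = radSum c T r := fun r r' =>
    Finset.sum_congr rfl fun k hk => by simp [mixBits, hk]
  have hTc : ∀ r r' : ι → Bool, radSum c Tᶜ (mixBits T r r') = radSum c Tᶜ r' := fun r r' =>
    Finset.sum_congr rfl fun k hk => by simp [mixBits, Finset.mem_compl.mp hk]
  have hind := expect_mixBits T fun r : ι → Bool => min (radSum c T r ^ 2) (radSum c Tᶜ r ^ 2)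
  simp only [hT, hTc] at hind
  have hpt : ∀ x y : ℝ, 0 ≤ x → 0 ≤ y → u * (min (x / V) 1 * min (y / W) 1) ≤ min x y := by
    intro x y hx hy
    have a0 : 0 ≤ min (x / V) 1 := le_min (by positivity) zero_le_one
    have b0 : 0 ≤ min (y / W) 1 := le_min (by positivity) zero_le_one
    have a1 : min (x / V) 1 ≤ 1 := min_le_right _ _
    have b1 : min (y / W) 1 ≤ 1 := min_le_right _ _
    have a2 : V * min (x / V) 1 ≤ x := by
      calc V * min (x / V) 1 ≤ V * (x / V) := by gcongr; exact min_le_left _ _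
        _ = x := by field_simp
    have b2 : W * min (y / W) 1 ≤ y := by
      calc W * min (y / W) 1 ≤ W * (y / W) := by gcongr; exact min_le_left _ _
        _ = y := by field_simp
    have uV : u ≤ V := min_le_left _ _
    have uW : u ≤ W := min_le_right _ _
    refine le_min ?_ ?_
    · calc u * (min (x / V) 1 * min (y / W) 1) ≤ V * (min (x / V) 1 * 1) := by gcongr
        _ ≤ x := by simpa using a2
    · calc u * (min (x / V) 1 * min (y / W) 1) ≤ W * (1 * min (y / W) 1) := by gcongr
        _ ≤ y := by simpa using b2
  have hprod : u * ((𝔼 r : ι → Bool, min (radSum c T r ^ 2 / V) 1)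
      * 𝔼 r : ι → Bool, min (radSum c Tᶜ r ^ 2 / W) 1)
      ≤ 𝔼 p : (ι → Bool) × (ι → Bool), min (radSum c T p.1 ^ 2) (radSum c Tᶜ p.2 ^ 2) := by
    rw [Finset.expect_mul_expect, ← Finset.univ_product_univ, Finset.expect_product,
      Finset.mul_expect]
    refine Finset.expect_le_expect fun r _ => ?_
    rw [Finset.mul_expect]
    exact Finset.expect_le_expect fun r' _ => hpt _ _ (sq_nonneg _) (sq_nonneg _)
  have h16 : u * (1 / 4 * (1 / 4)) ≤ u * ((𝔼 r : ι → Bool, min (radSum c T r ^ 2 / V) 1)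
      * 𝔼 r : ι → Bool, min (radSum c Tᶜ r ^ 2 / W) 1) := by gcongr
  linarith

/-- A nonnegative weight that no bipartition splits into two parts of weight more than `B` is
at most `3B` outside some set of at most one point. -/
lemma exists_card_le_one_sum_compl_le {w : ι → ℝ} {B : ℝ} (hB : 0 ≤ B)
    (h : ∀ T : Finset ι, min (∑ k ∈ T, w k) (∑ k ∈ Tᶜ, w k) ≤ B) :
    ∃ E : Finset ι, #E ≤ 1 ∧ ∑ k ∈ Eᶜ, w k ≤ 3 * B := by
  by_cases hbig : ∃ k, B < w k
  · obtain ⟨k, hk⟩ := hbig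
    refine ⟨{k}, by simp, ?_⟩
    have := h {k}
    rw [Finset.sum_singleton, min_le_iff] at this
    rcases this with h1 | h1 <;> linarith
  push Not at hbig
  refine ⟨∅, by simp, ?_⟩
  rw [Finset.compl_empty]
  by_contra! hlt
  -- Grow `T` one point at a time. A set of weight at most B stays below 2B after adding a point; as
  -- the total exceeds 3B, its complement is heavier than B, so the bipartition bound returns the
  -- set to weight at most B.
  have key : ∀ T : Finset ι, ∑ k ∈ T, w k ≤ B := by
    intro T
    induction T using Finset.induction_on with
    | empty => simpa using hB
    | insert k T hk ih =>
      have h1 := h (insert k T)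
      rw [min_le_iff] at h1
      rcases h1 with h1 | h1
      · exact h1
      · have h2 := Finset.sum_add_sum_compl (insert k T) w
        rw [Finset.sum_insert hk] at h2
        have := hbig k
        linarith
  have := key univ
  linarith

/-- The FKN theorem on the cube, in `L₂`: all but at most one of the coefficients of an affine
function close to Boolean are small. -/
lemma exists_card_le_one_sum_sq_le (d : ℝ) (c : ι → ℝ) :
    ∃ E : Finset ι, #E ≤ 1 ∧
      ∑ k ∈ Eᶜ, c k ^ 2 ≤ 768 * 𝔼 r : ι → Bool, distBool (d + radSum c univ r) ^ 2 := by
  obtain ⟨E, h1, h2⟩ := exists_card_le_one_sum_compl_le (w := fun k => c k ^ 2)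
    (mul_nonneg (by norm_num : (0:ℝ) ≤ 256) (Finset.expect_nonneg fun _ _ => sq_nonneg _))
    (min_variance_radSum_le d c)
  exact ⟨E, h1, by linarith⟩

/-- The distance to the nearest integer. -/
def distInt (x : ℝ) : ℝ := |x - round x|

lemma distInt_nonneg (x : ℝ) : 0 ≤ distInt x := abs_nonneg _

lemma distInt_le (x : ℝ) (z : ℤ) : distInt x ≤ |x - z| := round_le x z

lemma distInt_le_abs (x : ℝ) : distInt x ≤ |x| := by simpa using distInt_le x 0

lemma distInt_le_distBool (x : ℝ) : distInt x ≤ distBool x := by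
  refine le_min ?_ ?_
  · simpa using distInt_le x 0
  · simpa using distInt_le x 1

lemma distInt_neg (x : ℝ) : distInt (-x) = distInt x := by
  have h : ∀ y : ℝ, distInt (-y) ≤ distInt y := fun y => by
    refine (distInt_le (-y) (-round y)).trans (le_of_eq ?_)
    unfold distInt
    push_cast
    rw [← abs_neg]; congr 1; ring
  exact le_antisymm (h x) (by simpa using h (-x))

lemma distInt_sub_le (x y : ℝ) : distInt (x - y) ≤ distInt x + distInt y := by
  refine (distInt_le (x - y) (round x - round y)).trans ?_
  unfold distInt
  push_cast
  calc |x - y - (round x - round y)| = |(x - round x) - (y - round y)| := by congr 1; ring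
    _ ≤ _ := abs_sub _ _

/-- Flipping sign `k` moves the value by twice the coefficient, and a difference of two numbers near
{0,1} is near an integer. Unlike the smallness bound, this holds for every coefficient, including
the exceptional one. -/
lemma distInt_two_mul_coeff_sq_le (d : ℝ) (c : ι → ℝ) (k : ι) :
    distInt (2 * c k) ^ 2 ≤ 4 * 𝔼 r : ι → Bool, distBool (d + radSum c univ r) ^ 2 := by
  set F : (ι → Bool) → ℝ := fun r => distBool (d + radSum c univ r) ^ 2 with hF
  have hpt : ∀ r : ι → Bool, distInt (2 * c k) ^ 2 ≤ 2 * (F r + F (flipBits {k} r)) := by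
    intro r
    have hs : ∀ r' : ι → Bool, radSum c univ r' = c k * bitSign (r' k) + radSum c (univ.erase k) r' :=
      fun r' => (Finset.add_sum_erase _ _ (Finset.mem_univ k)).symm
    have hd : radSum c (univ.erase k) (flipBits {k} r) = radSum c (univ.erase k) r :=
      radSum_flipBits_of_disjoint c (by simp) r
    have h1 : distInt (2 * c k) ≤ distBool (d + radSum c univ r)
        + distBool (d + radSum c univ (flipBits {k} r)) := by
      have e : distInt (2 * c k) = distInt ((d + radSum c univ r)
          - (d + radSum c univ (flipBits {k} r))) := by
        rw [hs, hs (flipBits _ _), hd, flipBits_apply, if_pos (by simp), bitSign_not]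
        cases r k
        · rw [← distInt_neg]; congr 1; simp [bitSign]; ring
        · congr 1; simp [bitSign]; ring
      rw [e]
      exact (distInt_sub_le _ _).trans (add_le_add (distInt_le_distBool _) (distInt_le_distBool _))
    have h0 := distInt_nonneg (2 * c k)
    simp only [hF]
    nlinarith [sq_nonneg (distBool (d + radSum c univ r)
        - distBool (d + radSum c univ (flipBits {k} r)))]
  calc distInt (2 * c k) ^ 2 = 𝔼 _r : ι → Bool, distInt (2 * c k) ^ 2 := by simp
    _ ≤ 𝔼 r : ι → Bool, 2 * (F r + F (flipBits {k} r)) := Finset.expect_le_expect fun r _ => hpt r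
    _ = _ := by
      rw [← Finset.mul_expect, Finset.expect_add_distrib, expect_flipBits]; ring

end Cube

/-! ### Averages over permutations as sums over embeddings -/

section EmbeddingAverages

variable {α β X : Type*} [Fintype α] [Fintype β] [Fintype X]

lemma exists_perm_trans_eq (e e' : α ↪ X) : ∃ θ : Equiv.Perm X, e.trans θ.toEmbedding = e' := by
  classical
  let g : Set.range e ≃ Set.range e' :=
    (Equiv.ofInjective e e.injective).symm.trans (Equiv.ofInjective e' e'.injective)
  refine ⟨g.extendSubtype, ?_⟩
  ext a
  have h := g.extendSubtype_apply_of_mem (e a) ⟨a, rfl⟩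
  simp only [Function.Embedding.trans_apply, Equiv.coe_toEmbedding]
  rw [h]
  have : (Equiv.ofInjective e e.injective).symm ⟨e a, ⟨a, rfl⟩⟩ = a := by
    rw [Equiv.symm_apply_eq]; rfl
  simp [g, this]

/-- Permutations act transitively on embeddings, so the average does not depend on `e`; averaging it
over all embeddings as well gives the sum. -/
lemma card_mul_expect_trans_perm [DecidableEq X] (e : α ↪ X) (F : (α ↪ X) → ℝ) :
    (Fintype.card (α ↪ X) : ℝ) * 𝔼 π : Equiv.Perm X, F (e.trans π.toEmbedding) = ∑ t, F t := by
  classical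
  have h1 : ∀ e' : α ↪ X, 𝔼 π : Equiv.Perm X, F (e'.trans π.toEmbedding)
      = 𝔼 π : Equiv.Perm X, F (e.trans π.toEmbedding) := by
    intro e'
    obtain ⟨θ, rfl⟩ := exists_perm_trans_eq e e'
    exact Fintype.expect_equiv (Equiv.mulRight θ) _ _ fun π => rfl
  have h2 : ∑ e' : α ↪ X, 𝔼 π : Equiv.Perm X, F (e'.trans π.toEmbedding)
      = (Fintype.card (α ↪ X) : ℝ) * 𝔼 π : Equiv.Perm X, F (e.trans π.toEmbedding) := by
    rw [Finset.sum_congr rfl fun e' _ => h1 e', Finset.sum_const, nsmul_eq_mul, Finset.card_univ]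
  rw [← h2, ← Finset.expect_sum_comm]
  have h3 : ∀ π : Equiv.Perm X, ∑ e' : α ↪ X, F (e'.trans π.toEmbedding) = ∑ t, F t := fun π =>
    Fintype.sum_equiv (Equiv.embeddingCongr (Equiv.refl α) π) _ _ fun e' => by
      congr 1
  simp [h3]

lemma card_sq_mul_expect_trans_perm [DecidableEq X] (e : α ↪ X) (F : (α ↪ X) → (α ↪ X) → ℝ) :
    (Fintype.card (α ↪ X) : ℝ) ^ 2 * 𝔼 ρ : Equiv.Perm X, 𝔼 σ : Equiv.Perm X,
      F (e.trans ρ.toEmbedding) (e.trans σ.toEmbedding) = ∑ t, ∑ u, F t u := by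
  rw [sq, mul_assoc, Finset.mul_expect, ← card_mul_expect_trans_perm e fun t => ∑ u, F t u]
  congr 2
  funext ρ
  rw [card_mul_expect_trans_perm e fun u => F (e.trans ρ.toEmbedding) u]

/-- An embedding of the sum type is a pair of embeddings with disjoint ranges; dropping the
disjointness only adds nonnegative terms. -/
lemma sum_embedding_sum_le (Φ : (α ↪ X) → (α ↪ X) → ℝ) (Ψ : (β ↪ X) → (β ↪ X) → ℝ)
    (hΦ : ∀ t u, 0 ≤ Φ t u) (hΨ : ∀ t u, 0 ≤ Ψ t u) :
    ∑ t : α ⊕ β ↪ X, ∑ u : α ⊕ β ↪ X,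
      Φ (Function.Embedding.inl.trans t) (Function.Embedding.inl.trans u)
        * Ψ (Function.Embedding.inr.trans t) (Function.Embedding.inr.trans u)
      ≤ (∑ t, ∑ u, Φ t u) * ∑ t, ∑ u, Ψ t u := by
  classical
  have hinj : Function.Injective fun t : α ⊕ β ↪ X =>
      ((Function.Embedding.inl.trans t : α ↪ X), (Function.Embedding.inr.trans t : β ↪ X)) := by
    intro t t' h
    simp only [Prod.mk.injEq] at h
    ext x
    rcases x with a | b
    · exact congrArg (fun g : α ↪ X => g a) h.1
    · exact congrArg (fun g : β ↪ X => g b) h.2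
  have hinj2 := hinj.prodMap hinj
  have hle := Finset.sum_le_univ_sum_of_nonneg
    (s := (univ : Finset ((α ⊕ β ↪ X) × (α ⊕ β ↪ X))).map ⟨_, hinj2⟩)
    (f := fun q : ((α ↪ X) × (β ↪ X)) × ((α ↪ X) × (β ↪ X)) =>
      Φ q.1.1 q.2.1 * Ψ q.1.2 q.2.2) (fun q => mul_nonneg (hΦ _ _) (hΨ _ _))
  rw [Finset.sum_map] at hle
  have e1 : (∑ t, ∑ u, Φ t u) * ∑ t, ∑ u, Ψ t u
      = ∑ q : ((α ↪ X) × (β ↪ X)) × ((α ↪ X) × (β ↪ X)), Φ q.1.1 q.2.1 * Ψ q.1.2 q.2.2 := by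
    simp only [Fintype.sum_prod_type, Finset.sum_mul_sum]
  rw [e1]
  simp only [Fintype.sum_prod_type] at hle ⊢
  exact hle

end EmbeddingAverages

/-! ### Random swaps of pairs: a cube inside the symmetric group -/

section Permutations

variable {n : ℕ}

/-- The linear function with coefficient matrix `c`. -/
def lin (c : Fin n → Fin n → ℝ) (π : Equiv.Perm (Fin n)) : ℝ := ∑ i, c i (π i)

/-- The alternating sum of `c` over the rectangle with rows `i, i'` and columns `j, j'`. -/
def rect {R : Type*} [AddCommGroup R] (c : Fin n → Fin n → R) (i i' j j' : Fin n) : R :=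
  c i j + c i' j' - c i j' - c i' j

lemma IsLinear.exists_lin {f : Equiv.Perm (Fin n) → ℝ} (hf : IsLinear f) :
    ∃ c : Fin n → Fin n → ℝ, f = lin c := by
  obtain ⟨c, hc⟩ := hf
  refine ⟨c, funext fun π => ?_⟩
  rw [hc]
  simp [lin, cosetIndicator]

/-- The `k`-th pair of consecutive positions. -/
def pairPos : Fin (n / 2) × Bool ↪ Fin n where
  toFun x := ⟨2 * x.1.1 + x.2.toNat, by
    have := x.1.2; have := x.2.toNat_le; omega⟩
  inj' := by
    rintro ⟨k, b⟩ ⟨l, b'⟩ h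
    have h' : 2 * k.1 + b.toNat = 2 * l.1 + b'.toNat := congrArg Fin.val h
    have := b.toNat_le
    have := b'.toNat_le
    have h1 : k = l := Fin.ext (by omega)
    have h2 : b.toNat = b'.toNat := by omega
    rw [h1]
    cases b <;> cases b' <;> simp_all

/-- Swap the `k`-th pair of positions whenever `r k` is false. -/
def pairSwap (r : Fin (n / 2) → Bool) : Equiv.Perm (Fin n) :=
  Equiv.Perm.viaFintypeEmbedding
    (Function.Involutive.toPerm
      (fun x : Fin (n / 2) × Bool => (x.1, if r x.1 then x.2 else !x.2))
      (by rintro ⟨k, b⟩; cases h : r k <;> simp [h])) pairPos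

lemma pairSwap_pairPos (r : Fin (n / 2) → Bool) (k : Fin (n / 2)) (b : Bool) :
    pairSwap r (pairPos (k, b)) = pairPos (k, if r k then b else !b) := by
  unfold pairSwap
  rw [Equiv.Perm.viaFintypeEmbedding_apply_image]
  rfl

lemma pairSwap_of_notMem (r : Fin (n / 2) → Bool) {x : Fin n} (hx : x ∉ Set.range (pairPos (n := n))) :
    pairSwap r x = x := by
  unfold pairSwap
  exact Equiv.Perm.viaFintypeEmbedding_apply_notMem_range _ _ hx

/-- The rectangle of `c` at the `k`-th pair of rows in the order `ρ` and columns in the order `σ`. -/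
def pairRect {R : Type*} [AddCommGroup R] (c : Fin n → Fin n → R) (ρ σ : Equiv.Perm (Fin n))
    (k : Fin (n / 2)) : R :=
  rect c (ρ (pairPos (k, false))) (ρ (pairPos (k, true))) (σ (pairPos (k, false)))
    (σ (pairPos (k, true)))

/-- Swapping the `k`-th pair subtracts its rectangle. In terms of signs this makes the function
affine with coefficients half the rectangles, so the cube results apply. -/
lemma lin_pairSwap (c : Fin n → Fin n → ℝ) (ρ σ : Equiv.Perm (Fin n)) (r : Fin (n / 2) → Bool) :
    lin c (σ * pairSwap r * ρ⁻¹) = (lin c (σ * ρ⁻¹) - ∑ k, pairRect c ρ σ k / 2)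
      + radSum (fun k => pairRect c ρ σ k / 2) univ r := by
  have h1 : ∀ τ : Equiv.Perm (Fin n), lin c (σ * τ * ρ⁻¹) = ∑ x, c (ρ x) (σ (τ x)) := by
    intro τ
    unfold lin
    rw [← Equiv.sum_comp ρ]
    simp
  have h2 : lin c (σ * ρ⁻¹) = ∑ x, c (ρ x) (σ x) := by simpa using h1 1
  have h3 : ∑ x, (c (ρ x) (σ (pairSwap r x)) - c (ρ x) (σ x))
      = ∑ y : Fin (n / 2) × Bool, (c (ρ (pairPos y)) (σ (pairSwap r (pairPos y)))
        - c (ρ (pairPos y)) (σ (pairPos y))) := by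
    rw [← Finset.sum_map univ pairPos fun x => c (ρ x) (σ (pairSwap r x)) - c (ρ x) (σ x)]
    symm
    refine Finset.sum_subset (Finset.subset_univ _) fun x _ hx => ?_
    rw [pairSwap_of_notMem r (by simpa using hx), sub_self]
  rw [Finset.sum_sub_distrib] at h3
  rw [h1, h2]
  have h4 : ∑ y : Fin (n / 2) × Bool, (c (ρ (pairPos y)) (σ (pairSwap r (pairPos y)))
        - c (ρ (pairPos y)) (σ (pairPos y)))
      = ∑ k, (pairRect c ρ σ k / 2 * bitSign (r k) - pairRect c ρ σ k / 2) := by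
    rw [Fintype.sum_prod_type]
    refine Finset.sum_congr rfl fun k _ => ?_
    rw [Fintype.sum_bool, pairSwap_pairPos, pairSwap_pairPos]
    cases r k
    · simp [bitSign, pairRect, rect]; ring
    · simp [bitSign]
  rw [h4, Finset.sum_sub_distrib] at h3
  unfold radSum
  linarith

/-- The mean squared distance to `{0,1}` over all swaps of consecutive pairs. -/
def pairDist (c : Fin n → Fin n → ℝ) (ρ σ : Equiv.Perm (Fin n)) : ℝ :=
  𝔼 r : Fin (n / 2) → Bool, distBool (lin c (σ * pairSwap r * ρ⁻¹)) ^ 2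

lemma pairDist_nonneg (c : Fin n → Fin n → ℝ) (ρ σ : Equiv.Perm (Fin n)) : 0 ≤ pairDist c ρ σ :=
  Finset.expect_nonneg fun _ _ => sq_nonneg _

lemma expect_pairDist (c : Fin n → Fin n → ℝ) :
    𝔼 ρ : Equiv.Perm (Fin n), 𝔼 σ : Equiv.Perm (Fin n), pairDist c ρ σ
      = mean fun π => distBool (lin c π) ^ 2 := by
  have h : ∀ ρ : Equiv.Perm (Fin n), 𝔼 σ : Equiv.Perm (Fin n), pairDist c ρ σ
      = mean fun π => distBool (lin c π) ^ 2 := by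
    intro ρ
    unfold pairDist
    rw [Finset.expect_comm]
    have h2 : ∀ r : Fin (n / 2) → Bool, 𝔼 σ : Equiv.Perm (Fin n),
        distBool (lin c (σ * pairSwap r * ρ⁻¹)) ^ 2 = mean fun π => distBool (lin c π) ^ 2 := fun r =>
      Fintype.expect_equiv (Equiv.mulRight (pairSwap r * ρ⁻¹)) _ _ fun σ => by
        simp [mul_assoc]
    simp [h2]
  simp [h]

lemma exists_sum_pairRect_sq_le (c : Fin n → Fin n → ℝ) (ρ σ : Equiv.Perm (Fin n)) :
    ∃ E : Finset (Fin (n / 2)), #E ≤ 1 ∧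
      ∑ k ∈ Eᶜ, pairRect c ρ σ k ^ 2 ≤ 3072 * pairDist c ρ σ := by
  obtain ⟨E, h1, h2⟩ := exists_card_le_one_sum_sq_le
    (lin c (σ * ρ⁻¹) - ∑ k, pairRect c ρ σ k / 2) fun k => pairRect c ρ σ k / 2
  refine ⟨E, h1, ?_⟩
  simp only [← lin_pairSwap] at h2
  simp only [div_pow, ← Finset.sum_div] at h2
  unfold pairDist
  linarith

lemma distInt_pairRect_sq_le (c : Fin n → Fin n → ℝ) (ρ σ : Equiv.Perm (Fin n)) (k : Fin (n / 2)) :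
    distInt (pairRect c ρ σ k) ^ 2 ≤ 4 * pairDist c ρ σ := by
  have h := distInt_two_mul_coeff_sq_le
    (lin c (σ * ρ⁻¹) - ∑ k, pairRect c ρ σ k / 2) (fun k => pairRect c ρ σ k / 2) k
  simp only [← lin_pairSwap] at h
  rw [mul_div_cancel₀ _ (two_ne_zero)] at h
  exact h

/-- The exceptional rectangle is controlled by integrality (4), the others by smallness (3072); so
no exception survives. -/
lemma sum_distInt_pairRect_sq_le (c : Fin n → Fin n → ℝ) (ρ σ : Equiv.Perm (Fin n)) :
    ∑ k, distInt (pairRect c ρ σ k) ^ 2 ≤ 3076 * pairDist c ρ σ := by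
  obtain ⟨E, h1, h2⟩ := exists_sum_pairRect_sq_le c ρ σ
  have h0 := pairDist_nonneg c ρ σ
  have hE : ∑ k ∈ E, distInt (pairRect c ρ σ k) ^ 2 ≤ 4 * pairDist c ρ σ := by
    calc _ ≤ ∑ k ∈ E, 4 * pairDist c ρ σ := Finset.sum_le_sum fun k _ => distInt_pairRect_sq_le c ρ σ k
      _ = #E * (4 * pairDist c ρ σ) := by rw [Finset.sum_const, nsmul_eq_mul]
      _ ≤ 1 * (4 * pairDist c ρ σ) := by gcongr; exact_mod_cast h1
      _ = _ := one_mul _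
  have hEc : ∑ k ∈ Eᶜ, distInt (pairRect c ρ σ k) ^ 2 ≤ ∑ k ∈ Eᶜ, pairRect c ρ σ k ^ 2 := by
    refine Finset.sum_le_sum fun k _ => ?_
    rw [← sq_abs (pairRect c ρ σ k)]
    exact pow_le_pow_left₀ (distInt_nonneg _) (distInt_le_abs _) 2
  have := Finset.sum_add_sum_compl E fun k => distInt (pairRect c ρ σ k) ^ 2
  linarith

/-- The `k`-th pair of consecutive positions as an embedding of two points. -/
def pairEmb (k : Fin (n / 2)) : Bool ↪ Fin n :=
  ⟨fun b => pairPos (k, b), fun b b' h => by simpa using h⟩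

/-- The rectangle of `c` with rows `t` and columns `u`. -/
def embRect {R : Type*} [AddCommGroup R] (c : Fin n → Fin n → R) (t u : Bool ↪ Fin n) : R :=
  rect c (t false) (t true) (u false) (u true)

lemma embRect_pairEmb {R : Type*} [AddCommGroup R] (c : Fin n → Fin n → R)
    (ρ σ : Equiv.Perm (Fin n)) (k : Fin (n / 2)) :
    embRect c ((pairEmb k).trans ρ.toEmbedding) ((pairEmb k).trans σ.toEmbedding)
      = pairRect c ρ σ k := rfl

lemma sum_bool_embedding (F : Fin n → Fin n → ℝ) (hF : ∀ i, F i i = 0) :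
    ∑ t : Bool ↪ Fin n, F (t false) (t true) = ∑ i, ∑ i', F i i' := by
  have hinj : Function.Injective fun t : Bool ↪ Fin n => (t false, t true) := by
    intro t t' h
    simp only [Prod.mk.injEq] at h
    ext b
    cases b
    · rw [h.1]
    · rw [h.2]
  rw [← Fintype.sum_prod_type' (f := F)]
  have := Finset.sum_map (univ : Finset (Bool ↪ Fin n)) ⟨_, hinj⟩ fun x : Fin n × Fin n => F x.1 x.2
  rw [← Finset.sum_subset (Finset.subset_univ (univ.map ⟨_, hinj⟩)), this]
  · rfl
  rintro ⟨i, i'⟩ _ hx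
  by_cases h : i = i'
  · subst h; exact hF i
  · exfalso
    apply hx
    rw [Finset.mem_map]
    have he : Function.Injective fun b : Bool => if b then i' else i := by
      intro b b' hb
      cases b <;> cases b' <;> simp_all [eq_comm]
    exact ⟨⟨_, he⟩, Finset.mem_univ _, by simp⟩

lemma sum_sum_embRect {R : Type*} [AddCommGroup R] (F : R → ℝ) (hF : F 0 = 0)
    (c : Fin n → Fin n → R) :
    ∑ t, ∑ u, F (embRect c t u) = ∑ i, ∑ i', ∑ j, ∑ j', F (rect c i i' j j') := by
  have h : ∀ t : Bool ↪ Fin n, ∑ u, F (embRect c t u)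
      = ∑ j, ∑ j', F (rect c (t false) (t true) j j') := fun t =>
    sum_bool_embedding (fun j j' => F (rect c (t false) (t true) j j')) fun j => by
      simp [rect, hF]
  rw [Finset.sum_congr rfl fun t _ => h t]
  exact sum_bool_embedding (fun i i' => ∑ j, ∑ j', F (rect c i i' j j')) fun i => by
    simp [rect, hF]

lemma card_bool_embedding : (Fintype.card (Bool ↪ Fin n) : ℝ) = n * (n - 1) := by
  rw [Fintype.card_embedding_eq]
  simp only [Fintype.card_fin, Fintype.card_bool]
  rcases n with _ | n
  · simp
  · rw [Nat.descFactorial_succ, Nat.descFactorial_one]; push_cast; simp; ring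

/-- The rectangles of a linear function close to Boolean are close to integers. -/
lemma sum_distInt_rect_sq_le {c : Fin n → Fin n → ℝ} {ε : ℝ}
    (h : mean (fun π => distBool (lin c π) ^ 2) ≤ ε) :
    ((n / 2 : ℕ) : ℝ) * ∑ i, ∑ i', ∑ j, ∑ j', distInt (rect c i i' j j') ^ 2
      ≤ (n * (n - 1)) ^ 2 * (3076 * ε) := by
  have h1 : 𝔼 ρ : Equiv.Perm (Fin n), 𝔼 σ : Equiv.Perm (Fin n),
      ∑ k, distInt (pairRect c ρ σ k) ^ 2 ≤ 3076 * ε := by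
    calc _ ≤ 𝔼 ρ : Equiv.Perm (Fin n), 𝔼 σ : Equiv.Perm (Fin n), 3076 * pairDist c ρ σ :=
          Finset.expect_le_expect fun ρ _ => Finset.expect_le_expect fun σ _ =>
            sum_distInt_pairRect_sq_le c ρ σ
      _ = 3076 * mean (fun π => distBool (lin c π) ^ 2) := by
          simp only [← Finset.mul_expect, expect_pairDist]
      _ ≤ _ := by gcongr
  have h2 : ∀ k : Fin (n / 2), ((n : ℝ) * (n - 1)) ^ 2 *
      𝔼 ρ : Equiv.Perm (Fin n), 𝔼 σ : Equiv.Perm (Fin n), distInt (pairRect c ρ σ k) ^ 2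
      = ∑ i, ∑ i', ∑ j, ∑ j', distInt (rect c i i' j j') ^ 2 := by
    intro k
    rw [← sum_sum_embRect (fun x => distInt x ^ 2) (by simp [distInt]),
      ← card_sq_mul_expect_trans_perm (pairEmb k) fun t u => distInt (embRect c t u) ^ 2,
      card_bool_embedding]
    rfl
  calc _ = ∑ k : Fin (n / 2), ((n : ℝ) * (n - 1)) ^ 2 *
      𝔼 ρ : Equiv.Perm (Fin n), 𝔼 σ : Equiv.Perm (Fin n), distInt (pairRect c ρ σ k) ^ 2 := by
        rw [Finset.sum_congr rfl fun k _ => h2 k]; simp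
    _ = ((n : ℝ) * (n - 1)) ^ 2 * 𝔼 ρ : Equiv.Perm (Fin n), 𝔼 σ : Equiv.Perm (Fin n),
      ∑ k, distInt (pairRect c ρ σ k) ^ 2 := by
        rw [← Finset.mul_sum]
        simp only [Finset.expect_sum_comm]
    _ ≤ _ := by gcongr

end Permutations

variable {n : ℕ}

/-! ### Moments of linear functions and rounding to integer coefficients -/

lemma mul_mean_apply (F : Fin n → ℝ) (i : Fin n) :
    (n : ℝ) * mean (fun π : Equiv.Perm (Fin n) => F (π i)) = ∑ j, F j := by
  let e : Unit ↪ Fin n := ⟨fun _ => i, fun _ _ _ => rfl⟩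
  have h := card_mul_expect_trans_perm e fun t => F (t ())
  rw [Fintype.card_congr (Equiv.uniqueEmbeddingEquivResult (α := Unit) (β := Fin n)),
    Fintype.card_fin] at h
  rw [← Equiv.sum_comp (Equiv.uniqueEmbeddingEquivResult (α := Unit) (β := Fin n))]
  exact h

lemma mul_mean_apply_mul_apply (e : Fin n → Fin n → ℝ) {i i' : Fin n} (hi : i ≠ i') :
    (n * (n - 1) : ℝ) * mean (fun π : Equiv.Perm (Fin n) => e i (π i) * e i' (π i'))
      = (∑ j, e i j) * (∑ j, e i' j) - ∑ j, e i j * e i' j := by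
  have he : Function.Injective fun b : Bool => if b then i' else i := by
    intro b b' hb
    cases b <;> cases b' <;> simp_all [eq_comm]
  have h := card_mul_expect_trans_perm ⟨_, he⟩ fun t : Bool ↪ Fin n =>
    (if t false = t true then 0 else e i (t false) * e i' (t true))
  rw [card_bool_embedding, sum_bool_embedding
    (fun j j' => if j = j' then 0 else e i j * e i' j') (fun j => by simp)] at h
  have h1 : ∀ π : Equiv.Perm (Fin n), π i ≠ π i' := fun π hc => hi (π.injective hc)
  have h2 : ∑ j, ∑ j', (if j = j' then 0 else e i j * e i' j')
      = (∑ j, e i j) * (∑ j, e i' j) - ∑ j, e i j * e i' j := by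
    rw [Finset.sum_mul_sum, ← Finset.sum_sub_distrib]
    refine Finset.sum_congr rfl fun j _ => ?_
    have : ∀ j', (if j = j' then 0 else e i j * e i' j')
        = e i j * e i' j' - if j = j' then e i j * e i' j' else 0 := fun j' => by
      split_ifs <;> simp
    simp only [this, Finset.sum_sub_distrib, Finset.sum_ite_eq, Finset.mem_univ, if_true]
  rw [← h2, ← h]
  unfold mean
  congr 2
  funext π
  simp [h1 π]

lemma mul_mean_lin (e : Fin n → Fin n → ℝ) : (n : ℝ) * mean (lin e) = ∑ i, ∑ j, e i j := by
  have : mean (lin e) = ∑ i, mean (fun π : Equiv.Perm (Fin n) => e i (π i)) := by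
    unfold mean lin; rw [Finset.expect_sum_comm]
  rw [this, Finset.mul_sum]
  exact Finset.sum_congr rfl fun i _ => mul_mean_apply _ i

lemma mul_mean_lin_sq (e : Fin n → Fin n → ℝ) :
    (n * (n - 1) : ℝ) * mean (fun π => lin e π ^ 2)
      = n * (∑ i, ∑ j, e i j ^ 2) + (∑ i, ∑ j, e i j) ^ 2 - (∑ i, (∑ j, e i j) ^ 2)
        - ∑ j, (∑ i, e i j) ^ 2 := by
  have h1 : mean (fun π => lin e π ^ 2)
      = ∑ i, ∑ i', mean (fun π : Equiv.Perm (Fin n) => e i (π i) * e i' (π i')) := by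
    unfold mean lin
    simp only [sq, Finset.sum_mul_sum, Finset.expect_sum_comm]
  have h2 : ∀ i i', (n * (n - 1) : ℝ) * mean (fun π : Equiv.Perm (Fin n) => e i (π i) * e i' (π i'))
      = (∑ j, e i j) * (∑ j, e i' j) - (∑ j, e i j * e i' j)
        + if i = i' then n * (∑ j, e i j ^ 2) - (∑ j, e i j) ^ 2 else 0 := by
    intro i i'
    by_cases h : i = i'
    · subst h
      have := mul_mean_apply (fun j => e i j * e i j) i
      rw [if_pos rfl]
      simp only [← sq] at this ⊢
      linear_combination ((n : ℝ) - 1) * this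
    · rw [if_neg h, mul_mean_apply_mul_apply e h, add_zero]
  rw [h1, Finset.mul_sum]
  simp only [Finset.mul_sum, h2, Finset.sum_add_distrib, Finset.sum_sub_distrib,
    Finset.sum_ite_eq, Finset.mem_univ, if_true]
  have h3 : ∑ i, ∑ i', ∑ j, e i j * e i' j = ∑ j, (∑ i, e i j) ^ 2 := by
    simp only [sq, Finset.sum_mul_sum]
    rw [Finset.sum_comm' (t' := univ) (s' := fun _ => univ) (by simp)]
    rw [Finset.sum_congr rfl fun i _ => Finset.sum_comm]
    rw [Finset.sum_comm]
    refine Finset.sum_congr rfl fun j _ => ?_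
    rw [Finset.sum_comm]
  rw [h3]
  simp only [← Finset.mul_sum, ← Finset.sum_mul]
  ring

/-- The variance of a linear function. -/
lemma mean_sub_mean_sq_le (hn : 2 ≤ n) (e : Fin n → Fin n → ℝ) :
    (n - 1 : ℝ) * mean (fun π => (lin e π - mean (lin e)) ^ 2) ≤ ∑ i, ∑ j, e i j ^ 2 := by
  have hn' : (2 : ℝ) ≤ n := by exact_mod_cast hn
  have h1 := mul_mean_lin e
  have h2 := mul_mean_lin_sq e
  set T := ∑ i, ∑ j, e i j with hT
  set Q := ∑ i, ∑ j, e i j ^ 2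
  set μ := mean (lin e) with hμ
  have hR : T ^ 2 ≤ n * ∑ i, (∑ j, e i j) ^ 2 := by
    simpa using sq_sum_le_card_mul_sum_sq (s := univ) (f := fun i => ∑ j, e i j)
  have hC : T ^ 2 ≤ n * ∑ j, (∑ i, e i j) ^ 2 := by
    rw [hT, Finset.sum_comm]
    simpa using sq_sum_le_card_mul_sum_sq (s := univ) (f := fun j => ∑ i, e i j)
  have hvar : mean (fun π => (lin e π - μ) ^ 2) = mean (fun π => lin e π ^ 2) - μ ^ 2 := by
    have : ∀ π : Equiv.Perm (Fin n), (lin e π - μ) ^ 2 = lin e π ^ 2 - 2 * μ * lin e π + μ ^ 2 :=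
      fun π => by ring
    unfold mean at hμ ⊢
    simp only [this, Finset.expect_add_distrib, Finset.expect_sub_distrib, ← Finset.mul_expect,
      Fintype.expect_const]
    rw [show (𝔼 π, lin e π) = μ from hμ.symm]; ring
  rw [hvar]
  set V := mean (fun π => lin e π ^ 2)
  set R := ∑ i, (∑ j, e i j) ^ 2
  set C := ∑ j, (∑ i, e i j) ^ 2
  refine le_of_mul_le_mul_left ?_ (show (0 : ℝ) < (n : ℝ) ^ 2 by positivity)
  have h3 : (n : ℝ) ^ 2 * ((n - 1) * (V - μ ^ 2))
      = n * (n * Q + T ^ 2 - R - C) - (n - 1) * T ^ 2 := by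
    rw [← h2, ← h1]; ring
  rw [h3]
  nlinarith [sq_nonneg T]

/-- A permutation meets every row and every column once, so subtracting row and column potentials
costs only a constant. The potentials chosen make the row and the column of the base cell vanish. -/
lemma lin_eq_lin_rect_add (c : Fin n → Fin n → ℝ) (i₀ j₀ : Fin n) (π : Equiv.Perm (Fin n)) :
    lin c π = lin (fun i j => rect c i i₀ j j₀) π
      + (∑ i, c i j₀ + ∑ j, c i₀ j - n * c i₀ j₀) := by
  have : ∑ i, c i₀ (π i) = ∑ j, c i₀ j := Equiv.sum_comp π _
  unfold lin rect
  simp only [Finset.sum_add_distrib, Finset.sum_sub_distrib, this]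
  simp
  ring

lemma exists_base_le {F : Fin n → Fin n → Fin n → Fin n → ℝ} (hn : 0 < n) {B : ℝ}
    (h : ∑ i, ∑ i', ∑ j, ∑ j', F i i' j j' ≤ n ^ 2 * B) :
    ∃ i₀ j₀, ∑ i, ∑ j, F i i₀ j j₀ ≤ B := by
  have : Nonempty (Fin n) := ⟨⟨0, hn⟩⟩
  have h1 : ∑ x : Fin n × Fin n, ∑ i, ∑ j, F i x.1 j x.2 ≤ ∑ _x : Fin n × Fin n, B := by
    rw [Fintype.sum_prod_type]
    have h2 : ∑ i', ∑ j', ∑ i, ∑ j, F i i' j j' = ∑ i, ∑ i', ∑ j, ∑ j', F i i' j j' := by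
      rw [Finset.sum_comm]
      rw [Finset.sum_comm (s := univ) (t := univ) (f := fun i i' => ∑ j, ∑ j', F i i' j j')]
      rw [Finset.sum_comm]
      refine Finset.sum_congr rfl fun i' _ => ?_
      rw [Finset.sum_comm]
      refine Finset.sum_congr rfl fun i _ => ?_
      rw [Finset.sum_comm]
    rw [h2]
    refine h.trans (le_of_eq ?_)
    rw [Finset.sum_const, Finset.card_univ, Fintype.card_prod, Fintype.card_fin, nsmul_eq_mul]
    push_cast; ring
  obtain ⟨x, _, hx⟩ := Finset.exists_le_of_sum_le Finset.univ_nonempty h1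
  exact ⟨x.1, x.2, hx⟩

lemma mean_mono {f g : Equiv.Perm (Fin n) → ℝ} (h : ∀ π, f π ≤ g π) : mean f ≤ mean g :=
  Finset.expect_le_expect fun π _ => h π

lemma mean_add (f g : Equiv.Perm (Fin n) → ℝ) : mean (fun π => f π + g π) = mean f + mean g :=
  Finset.expect_add_distrib _ _ _

lemma mean_const_mul (a : ℝ) (f : Equiv.Perm (Fin n) → ℝ) :
    mean (fun π => a * f π) = a * mean f :=
  (Finset.mul_expect _ _ _).symm

lemma mean_const (a : ℝ) : mean (fun _ : Equiv.Perm (Fin n) => a) = a :=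
  Fintype.expect_const a

lemma mean_nonneg {f : Equiv.Perm (Fin n) → ℝ} (h : ∀ π, 0 ≤ f π) : 0 ≤ mean f :=
  Finset.expect_nonneg fun π _ => h π

lemma distInt_add_int (x : ℝ) (z : ℤ) : distInt (x + z) = distInt x := by
  unfold distInt; rw [round_add_intCast]; push_cast; congr 1; ring

lemma distInt_sq_le_of_sub (x y : ℝ) : distInt x ^ 2 ≤ 2 * distInt y ^ 2 + 2 * (x - y) ^ 2 := by
  have h : distInt x ≤ distInt y + |x - y| := by
    have := distInt_sub_le y (y - x)
    rw [sub_sub_cancel] at this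
    refine this.trans ?_
    gcongr
    rw [abs_sub_comm]
    exact distInt_le_abs _
  have h0 := distInt_nonneg x
  nlinarith [sq_abs (x - y), sq_nonneg (|x - y| - distInt y)]

lemma lin_intCast (b : Fin n → Fin n → ℤ) (π : Equiv.Perm (Fin n)) :
    lin (fun i j => (b i j : ℝ)) π = ((∑ i, b i (π i) : ℤ) : ℝ) := by
  simp [lin]

/-- A linear function close to Boolean is close to a linear function with integer coefficients. -/
lemma exists_int_lin_close (hn : 2 ≤ n) {c : Fin n → Fin n → ℝ} {ε : ℝ}
    (h : mean (fun π => distBool (lin c π) ^ 2) ≤ ε) :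
    ∃ b : Fin n → Fin n → ℤ, mean (fun π => (lin c π - lin (fun i j => (b i j : ℝ)) π) ^ 2)
      ≤ 40000 * ε := by
  have hn' : (2 : ℝ) ≤ n := by exact_mod_cast hn
  have hε : 0 ≤ ε := (mean_nonneg fun π => sq_nonneg _).trans h
  have hm : ((n : ℝ) - 1) / 2 ≤ ((n / 2 : ℕ) : ℝ) := by
    have : n ≤ 2 * (n / 2) + 1 := by omega
    have : (n : ℝ) ≤ 2 * ((n / 2 : ℕ) : ℝ) + 1 := by exact_mod_cast this
    linarith
  have hS := sum_distInt_rect_sq_le h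
  set S := ∑ i, ∑ i', ∑ j, ∑ j', distInt (rect c i i' j j') ^ 2 with hSdef
  have hS0 : 0 ≤ S := Finset.sum_nonneg fun _ _ => Finset.sum_nonneg fun _ _ =>
    Finset.sum_nonneg fun _ _ => Finset.sum_nonneg fun _ _ => sq_nonneg _
  have hS1 : S ≤ n ^ 2 * (6152 * ε * (n - 1)) := by
    have h1 : ((n : ℝ) - 1) / 2 * S ≤ (n * (n - 1)) ^ 2 * (3076 * ε) :=
      (mul_le_mul_of_nonneg_right hm hS0).trans hS
    refine le_of_mul_le_mul_left ?_ (show (0 : ℝ) < ((n : ℝ) - 1) / 2 by linarith)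
    refine h1.trans (le_of_eq ?_)
    ring
  -- Some base cell does at least as well as the average over all n² of them. The surviving factor n
  -- - 1 is cancelled by the one in the variance bound.
  obtain ⟨i₀, j₀, hbase⟩ := exists_base_le (by omega) hS1
  set a : Fin n → Fin n → ℝ := fun i j => rect c i i₀ j j₀ with ha
  set e : Fin n → Fin n → ℝ := fun i j => a i j - round (a i j) with he
  set K := ∑ i, c i j₀ + ∑ j, c i₀ j - n * c i₀ j₀ with hK
  set μ := mean (lin e)
  set w : Equiv.Perm (Fin n) → ℝ := fun π => lin e π - μ with hw
  have hw2 : mean (fun π => w π ^ 2) ≤ 6152 * ε := by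
    have h1 := mean_sub_mean_sq_le hn e
    have h2 : ∑ i, ∑ j, e i j ^ 2 = ∑ i, ∑ j, distInt (rect c i i₀ j j₀) ^ 2 := by
      refine Finset.sum_congr rfl fun i _ => Finset.sum_congr rfl fun j _ => ?_
      rw [distInt, sq_abs]
    rw [h2] at h1
    refine le_of_mul_le_mul_left ?_ (show (0 : ℝ) < (n : ℝ) - 1 by linarith)
    linarith
  set κ := K + μ with hκ
  have hdec : ∀ π, lin c π = ((∑ i, round (a i (π i)) : ℤ) : ℝ) + κ + w π := by
    intro π
    rw [lin_eq_lin_rect_add c i₀ j₀ π, hw, hκ]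
    have : lin e π = lin a π - ((∑ i, round (a i (π i)) : ℤ) : ℝ) := by
      simp [lin, he]
    simp only [this]
    ring
  -- The function is an integer plus `κ` plus the centred rounding error `w`, and it is near {0,1};
  -- so the constant `κ` is itself near an integer.
  have hκ2 : distInt κ ^ 2 ≤ 12306 * ε := by
    have hpt : ∀ π, distInt κ ^ 2 ≤ 2 * distBool (lin c π) ^ 2 + 2 * w π ^ 2 := by
      intro π
      rw [← distInt_add_int κ (∑ i, round (a i (π i)))]
      refine (distInt_sq_le_of_sub _ (lin c π)).trans ?_
      have h3 : distInt (lin c π) ^ 2 ≤ distBool (lin c π) ^ 2 :=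
        pow_le_pow_left₀ (distInt_nonneg _) (distInt_le_distBool _) 2
      have h4 : κ + ((∑ i, round (a i (π i)) : ℤ) : ℝ) - lin c π = -w π := by
        rw [hdec π]; ring
      rw [h4, neg_sq]
      linarith
    have := mean_mono hpt
    rw [mean_const, mean_add, mean_const_mul, mean_const_mul] at this
    linarith
  -- The integer constant `round κ` is put in row `i₀`, which every permutation meets exactly once.
  refine ⟨fun i j => round (a i j) + if i = i₀ then round κ else 0, ?_⟩
  have hG : ∀ π : Equiv.Perm (Fin n), lin (fun i j =>
      ((round (a i j) + if i = i₀ then round κ else 0 : ℤ) : ℝ)) π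
      = ((∑ i, round (a i (π i)) : ℤ) : ℝ) + round κ := by
    intro π
    rw [lin_intCast, Finset.sum_add_distrib]
    simp
  have hpt : ∀ π : Equiv.Perm (Fin n), (lin c π - lin (fun i j =>
      ((round (a i j) + if i = i₀ then round κ else 0 : ℤ) : ℝ)) π) ^ 2
      ≤ 2 * distInt κ ^ 2 + 2 * w π ^ 2 := by
    intro π
    rw [hG, hdec, distInt, sq_abs]
    nlinarith [sq_nonneg (κ - round κ - w π)]
  have := mean_mono hpt
  rw [mean_add, mean_const, mean_const_mul] at this
  linarith

/-! ### Exactly Boolean integer functions -/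

lemma exists_perm_apply_two {X : Type*} [Fintype X] {i i' j j' : X} (hi : i ≠ i') (hj : j ≠ j') :
    ∃ π : Equiv.Perm X, π i = j ∧ π i' = j' := by
  have he : ∀ {x y : X}, x ≠ y → Function.Injective fun b : Bool => if b then y else x := by
    intro x y hxy b b' hb
    cases b <;> cases b' <;> simp_all [eq_comm]
  obtain ⟨π, hπ⟩ := exists_perm_trans_eq (⟨_, he hi⟩ : Bool ↪ X) ⟨_, he hj⟩
  refine ⟨π, ?_, ?_⟩
  · simpa using congrArg (fun t : Bool ↪ X => t false) hπ
  · simpa using congrArg (fun t : Bool ↪ X => t true) hπ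

/-- Integral duality for the assignment problem. -/
lemma exists_potential (b : Fin n → Fin n → ℤ) :
    ∃ (u w : Fin n → ℤ) (σ : Equiv.Perm (Fin n)),
      (∀ i j, u i + w j ≤ b i j) ∧ ∀ i, b i (σ i) = u i + w (σ i) := by
  obtain ⟨z, ⟨u, w, huw, hz⟩, hmax⟩ := Int.exists_greatest_of_bdd
    (P := fun z => ∃ u w : Fin n → ℤ, (∀ i j, u i + w j ≤ b i j) ∧ z = ∑ i, u i + ∑ j, w j)
    ⟨∑ i, b i i, by
      rintro z ⟨u, w, huw, rfl⟩
      rw [← Finset.sum_add_distrib]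
      exact Finset.sum_le_sum fun i _ => huw i i⟩
    ⟨_, fun i => -∑ j, |b i j|, fun _ => 0, by
      intro i j
      have h1 := Finset.single_le_sum (f := fun j => |b i j|) (fun j _ => abs_nonneg _)
        (Finset.mem_univ j)
      have h2 := neg_abs_le (b i j)
      linarith, rfl⟩
  -- Hall's condition for the tight cells. If it failed at `A`, raising `u` by 1 on `A` and lowering
  -- `w` by 1 on the tight neighbours `N` would stay feasible, since slacks are integers, and would
  -- raise the maximal objective by #A - #N > 0.
  have hall : ∀ A : Finset (Fin n),
      #A ≤ #(A.biUnion fun i => univ.filter fun j => b i j = u i + w j) := by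
    intro A
    by_contra! hlt
    set N := A.biUnion fun i => univ.filter fun j => b i j = u i + w j with hN
    have h := hmax _ ⟨fun i => u i + if i ∈ A then 1 else 0, fun j => w j - if j ∈ N then 1 else 0,
      by
        intro i j
        have h1 := huw i j
        by_cases hi : i ∈ A
        · by_cases hj : j ∈ N
          · simp only [hi, hj, if_true]; linarith
          · have h2 : b i j ≠ u i + w j := fun he => hj (by
              rw [hN, Finset.mem_biUnion]; exact ⟨i, hi, by simp [he]⟩)
            simp only [hi, hj, if_true, if_false]
            omega
        · simp only [hi, if_false]
          split_ifs <;> linarith, rfl⟩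
    simp only [Finset.sum_add_distrib, Finset.sum_sub_distrib, Finset.sum_ite_mem,
      Finset.univ_inter, Finset.sum_const, nsmul_eq_mul, mul_one] at h
    have : (#N : ℤ) < #A := by exact_mod_cast hlt
    linarith
  obtain ⟨f, hf, hft⟩ := (Finset.all_card_le_biUnion_card_iff_exists_injective _).1 hall
  refine ⟨u, w, Equiv.ofBijective f (Finite.injective_iff_bijective.1 hf), huw, fun i => ?_⟩
  simpa using hft i

/-- A Boolean linear function with integer coefficients is a dictator. -/
lemma isDictator_of_boolean (hn : 0 < n) {b : Fin n → Fin n → ℤ}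
    (h : ∀ π : Equiv.Perm (Fin n), ∑ i, b i (π i) = 0 ∨ ∑ i, b i (π i) = 1) :
    IsDictator (lin fun i j => (b i j : ℝ)) := by
  obtain ⟨u, w, σ, huw, hσ⟩ := exists_potential b
  set d : Fin n → Fin n → ℤ := fun i j => b i j - u i - w j with hd
  set k := ∑ i, u i + ∑ j, w j with hk
  have hd0 : ∀ i j, 0 ≤ d i j := fun i j => by have := huw i j; simp only [hd]; linarith
  have hsum : ∀ π : Equiv.Perm (Fin n), ∑ i, b i (π i) = k + ∑ i, d i (π i) := by
    intro π
    have := Equiv.sum_comp π w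
    simp only [hd, Finset.sum_sub_distrib, this]
    rw [hk]; ring
  have hkσ : ∑ i, b i (σ i) = k := by
    rw [hsum, Finset.sum_eq_zero fun i _ => ?_, add_zero]
    simp only [hd, hσ]; ring
  have hB : ∀ π, lin (fun i j => (b i j : ℝ)) π = 0 ∨ lin (fun i j => (b i j : ℝ)) π = 1 := by
    intro π
    rw [lin_intCast]
    exact_mod_cast h π
  refine ⟨hB, ?_⟩
  simp only [lin_intCast, Int.cast_inj, hsum, add_right_inj]
  -- The permutation `σ` uses only cells of zero slack, so `k` is the minimum of the function. If it
  -- is 1, the function is constant. If it is 0, a permutation cannot meet two cells of positive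
  -- slack, so these cells pairwise share a row or a column and hence all lie on one line.
  rcases h σ with h0 | h1
  · have hk0 : k = 0 := hkσ ▸ h0
    have hle : ∀ π : Equiv.Perm (Fin n), ∑ i, d i (π i) ≤ 1 := by
      intro π
      have := hsum π
      rcases h π with h2 | h2 <;> omega
    have hconf : ∀ i j i' j', d i j ≠ 0 → d i' j' ≠ 0 → i = i' ∨ j = j' := by
      intro i j i' j' h1 h2
      by_contra! hne
      obtain ⟨π, rfl, rfl⟩ := exists_perm_apply_two hne.1 hne.2
      have h3 : ∑ x ∈ {i, i'}, d x (π x) ≤ ∑ x, d x (π x) :=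
        Finset.sum_le_univ_sum_of_nonneg fun x => hd0 _ _
      rw [Finset.sum_pair hne.1] at h3
      have := hle π
      have := hd0 i (π i)
      have := hd0 i' (π i')
      omega
    by_cases hS : ∃ i j, d i j ≠ 0
    · obtain ⟨i, j, hij⟩ := hS
      by_cases hrow : ∀ i' j', d i' j' ≠ 0 → i' = i
      · left
        refine ⟨i, fun π τ hπ => ?_⟩
        have : ∀ π : Equiv.Perm (Fin n), ∑ x, d x (π x) = d i (π i) := fun π =>
          Finset.sum_eq_single i (fun x _ hx => by_contra fun hne => hx (hrow _ _ hne)) (by simp)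
        rw [this, this, hπ]
      · push Not at hrow
        obtain ⟨i', j', hij', hne⟩ := hrow
        have hj : j = j' := (hconf _ _ _ _ hij hij').resolve_left (Ne.symm hne)
        subst hj
        right
        have hcol : ∀ x y, d x y ≠ 0 → y = j := by
          intro x y hxy
          by_contra hy
          have h1 := (hconf _ _ _ _ hxy hij).resolve_right hy
          have h2 := (hconf _ _ _ _ hxy hij').resolve_right hy
          exact hne (h2.symm.trans h1)
        refine ⟨j, fun π τ hπ => ?_⟩
        have : ∀ π : Equiv.Perm (Fin n), ∑ x, d x (π x) = d (π⁻¹ j) j := fun π => by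
          rw [Finset.sum_eq_single (π⁻¹ j)
            (fun x _ hx => by_contra fun hne => hx (by
              rw [← hcol _ _ hne]; simp)) (by simp)]
          simp
        rw [this, this, hπ]
    · push Not at hS
      left
      refine ⟨⟨0, hn⟩, fun π τ _ => ?_⟩
      simp [hS]
  · have hk1 : k = 1 := hkσ ▸ h1
    have hzero : ∀ π : Equiv.Perm (Fin n), ∑ i, d i (π i) = 0 := by
      intro π
      have h2 := hsum π
      have h3 : 0 ≤ ∑ i, d i (π i) := Finset.sum_nonneg fun i _ => hd0 _ _
      rcases h π with h4 | h4 <;> omega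
    left
    refine ⟨⟨0, hn⟩, fun π τ _ => ?_⟩
    rw [hzero, hzero]

/-- An integer-valued linear function close enough to Boolean is a dictator. -/
lemma isDictator_of_mean_lt (hn : 0 < n) {b : Fin n → Fin n → ℤ}
    (h : (n.factorial : ℝ) * mean (fun π => distBool (lin (fun i j => (b i j : ℝ)) π) ^ 2) < 1) :
    IsDictator (lin fun i j => (b i j : ℝ)) := by
  refine isDictator_of_boolean hn fun π => ?_
  by_contra! hne
  have h1 : (1 : ℝ) ≤ distBool (lin (fun i j => (b i j : ℝ)) π) ^ 2 := by
    have : (1 : ℝ) ≤ distBool (lin (fun i j => (b i j : ℝ)) π) := by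
      rw [lin_intCast]
      refine le_min ?_ ?_
      · rw [sub_zero]
        exact_mod_cast Int.one_le_abs hne.1
      · exact_mod_cast Int.one_le_abs (sub_ne_zero.2 hne.2)
    exact one_le_pow₀ this
  have h2 : distBool (lin (fun i j => (b i j : ℝ)) π) ^ 2
      ≤ ∑ π, distBool (lin (fun i j => (b i j : ℝ)) π) ^ 2 :=
    Finset.single_le_sum (f := fun π => distBool (lin (fun i j => (b i j : ℝ)) π) ^ 2)
      (fun _ _ => sq_nonneg _) (Finset.mem_univ π)
  have h3 : (n.factorial : ℝ) * mean (fun π => distBool (lin (fun i j => (b i j : ℝ)) π) ^ 2)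
      = ∑ π, distBool (lin (fun i j => (b i j : ℝ)) π) ^ 2 := by
    unfold mean
    rw [Fintype.expect_eq_sum_div_card, Fintype.card_perm, Fintype.card_fin]
    field_simp
  linarith

/-! ### Factorial moments of the number of nonzero rectangles -/

/-- The indicator that the rectangle of `b` with rows `t` and columns `u` is nonzero. -/
def rectInd (b : Fin n → Fin n → ℤ) (t u : Bool ↪ Fin n) : ℝ :=
  if embRect b t u ≠ 0 then 1 else 0

lemma rectInd_nonneg (b : Fin n → Fin n → ℤ) (t u : Bool ↪ Fin n) : 0 ≤ rectInd b t u := by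
  unfold rectInd; split_ifs <;> norm_num

lemma rectInd_sq (b : Fin n → Fin n → ℤ) (t u : Bool ↪ Fin n) :
    rectInd b t u * rectInd b t u = rectInd b t u := by
  unfold rectInd; split_ifs <;> norm_num

/-- The indicator that the `k`-th rectangle of `b` in the orders `ρ`, `σ` is nonzero. -/
def pairInd (b : Fin n → Fin n → ℤ) (ρ σ : Equiv.Perm (Fin n)) (k : Fin (n / 2)) : ℝ :=
  rectInd b ((pairEmb k).trans ρ.toEmbedding) ((pairEmb k).trans σ.toEmbedding)

lemma pairInd_le_sq (b : Fin n → Fin n → ℤ) (ρ σ : Equiv.Perm (Fin n)) (k : Fin (n / 2)) :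
    pairInd b ρ σ k ≤ pairRect (fun i j => (b i j : ℝ)) ρ σ k ^ 2 := by
  have h : pairRect (fun i j => (b i j : ℝ)) ρ σ k = (pairRect b ρ σ k : ℤ) := by
    simp [pairRect, rect]
  unfold pairInd rectInd
  rw [embRect_pairEmb, h]
  split_ifs with h0
  · have : 1 ≤ |pairRect b ρ σ k| := Int.one_le_abs h0
    rw [← sq_abs]
    exact one_le_pow₀ (by exact_mod_cast this)
  · positivity

lemma pairInd_le_one (b : Fin n → Fin n → ℤ) (ρ σ : Equiv.Perm (Fin n)) (k : Fin (n / 2)) :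
    pairInd b ρ σ k ≤ 1 := by
  unfold pairInd rectInd; split_ifs <;> norm_num

/-- The exceptional pair counts at most 1; any other nonzero rectangle is an integer, so its square
is at least 1. -/
lemma sum_pairInd_le (b : Fin n → Fin n → ℤ) (ρ σ : Equiv.Perm (Fin n)) :
    ∑ k, pairInd b ρ σ k ≤ 1 + 3072 * pairDist (fun i j => (b i j : ℝ)) ρ σ := by
  obtain ⟨E, h1, h2⟩ := exists_sum_pairRect_sq_le (fun i j => (b i j : ℝ)) ρ σ
  rw [← Finset.sum_add_sum_compl E]
  refine add_le_add ?_ ((Finset.sum_le_sum fun k _ => pairInd_le_sq b ρ σ k).trans h2)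
  calc _ ≤ ∑ k ∈ E, (1 : ℝ) := Finset.sum_le_sum fun k _ => pairInd_le_one b ρ σ k
    _ ≤ 1 := by simpa using h1

lemma exists_nat_eq_sum_pairInd (b : Fin n → Fin n → ℤ) (ρ σ : Equiv.Perm (Fin n)) :
    ∃ N : ℕ, ∑ k, pairInd b ρ σ k = N := by
  refine ⟨#(univ.filter fun k => pairRect b ρ σ k ≠ 0), ?_⟩
  rw [Finset.card_filter]
  push_cast
  rfl

lemma sum_erase_mul {ι : Type*} [Fintype ι] [DecidableEq ι] {I : ι → ℝ}
    (hI : ∀ k, I k * I k = I k) :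
    ∑ k, ∑ l ∈ univ.erase k, I k * I l = (∑ k, I k) * (∑ k, I k - 1) := by
  have h : ∀ k, ∑ l ∈ univ.erase k, I k * I l = I k * (∑ k, I k - 1) := by
    intro k
    have := Finset.add_sum_erase univ I (Finset.mem_univ k)
    rw [← Finset.mul_sum, ← this]
    linear_combination (-1 : ℝ) * hI k
  rw [Finset.sum_congr rfl fun k _ => h k, ← Finset.sum_mul]

lemma sum_erase_erase_mul {ι : Type*} [Fintype ι] [DecidableEq ι] {I : ι → ℝ}
    (hI : ∀ k, I k * I k = I k) :
    ∑ k, ∑ l ∈ univ.erase k, ∑ h ∈ (univ.erase k).erase l, I k * I l * I h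
      = (∑ k, I k) * (∑ k, I k - 1) * (∑ k, I k - 2) := by
  have h : ∀ k, ∀ l ∈ univ.erase k, ∑ h ∈ (univ.erase k).erase l, I k * I l * I h
      = I k * I l * (∑ k, I k - 2) := by
    intro k l hl
    have h1 := Finset.add_sum_erase univ I (Finset.mem_univ k)
    have h2 := Finset.add_sum_erase (univ.erase k) I hl
    rw [← Finset.mul_sum, ← h1, ← h2]
    linear_combination -(I l * hI k) - I k * hI l
  rw [Finset.sum_congr rfl fun k _ => Finset.sum_congr rfl fun l hl => h k l hl]
  simp only [← Finset.sum_mul]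
  rw [sum_erase_mul hI]

/-- The left side is N(N-1)(18-N)/16 and N(18-N) ≤ 81 < 96, so it is at most 6(N-1). The cubic term
allows a quadratic quantity to be bounded by the linear excess over 1. -/
lemma falling_sub_le (N : ℕ) {y : ℝ} (hy : 0 ≤ y) (h : (N : ℝ) ≤ 1 + y) :
    (N : ℝ) * (N - 1) - (N * (N - 1) * (N - 2)) / 16 ≤ 6 * y := by
  rcases Nat.eq_zero_or_pos N with rfl | hN
  · simpa using hy
  · have h1 : (1 : ℝ) ≤ N := by exact_mod_cast hN
    nlinarith [mul_nonneg (sub_nonneg.2 h1) (sq_nonneg ((N : ℝ) - 9))]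

/-- Two embeddings with disjoint ranges, as an embedding of the sum. -/
def sumEmb {α β X : Type*} (e : α ↪ X) (e' : β ↪ X) (h : ∀ a b, e a ≠ e' b) : α ⊕ β ↪ X :=
  ⟨Sum.elim e e', e.injective.sumElim e'.injective h⟩

lemma pairEmb_ne {k l : Fin (n / 2)} (h : k ≠ l) (a b : Bool) : pairEmb k a ≠ pairEmb l b := by
  intro he
  have := (pairPos (n := n)).injective he
  simp only [Prod.mk.injEq] at this
  exact h this.1

/-- The indicator that two disjoint rectangles are both nonzero. -/
def rectInd₂ (b : Fin n → Fin n → ℤ) (t u : Bool ⊕ Bool ↪ Fin n) : ℝ :=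
  rectInd b (Function.Embedding.inl.trans t) (Function.Embedding.inl.trans u)
    * rectInd b (Function.Embedding.inr.trans t) (Function.Embedding.inr.trans u)

lemma rectInd₂_nonneg (b : Fin n → Fin n → ℤ) (t u : Bool ⊕ Bool ↪ Fin n) : 0 ≤ rectInd₂ b t u :=
  mul_nonneg (rectInd_nonneg _ _ _) (rectInd_nonneg _ _ _)

lemma card_mul_expect_pairInd (b : Fin n → Fin n → ℤ) (k : Fin (n / 2)) :
    (Fintype.card (Bool ↪ Fin n) : ℝ) ^ 2 * 𝔼 ρ : Equiv.Perm (Fin n), 𝔼 σ : Equiv.Perm (Fin n),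
      pairInd b ρ σ k = ∑ t, ∑ u, rectInd b t u :=
  card_sq_mul_expect_trans_perm (pairEmb k) (rectInd b)

lemma card_mul_expect_pairInd_mul (b : Fin n → Fin n → ℤ) {k l : Fin (n / 2)} (h : k ≠ l) :
    (Fintype.card (Bool ⊕ Bool ↪ Fin n) : ℝ) ^ 2 * 𝔼 ρ : Equiv.Perm (Fin n),
      𝔼 σ : Equiv.Perm (Fin n), pairInd b ρ σ k * pairInd b ρ σ l = ∑ t, ∑ u, rectInd₂ b t u :=
  card_sq_mul_expect_trans_perm (sumEmb (pairEmb k) (pairEmb l) (pairEmb_ne h)) (rectInd₂ b)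

lemma card_mul_expect_pairInd_mul_mul_le (b : Fin n → Fin n → ℤ) {k l h : Fin (n / 2)} (hkl : k ≠ l)
    (hkh : k ≠ h) (hlh : l ≠ h) :
    (Fintype.card ((Bool ⊕ Bool) ⊕ Bool ↪ Fin n) : ℝ) ^ 2 * 𝔼 ρ : Equiv.Perm (Fin n),
      𝔼 σ : Equiv.Perm (Fin n), pairInd b ρ σ k * pairInd b ρ σ l * pairInd b ρ σ h
      ≤ (∑ t, ∑ u, rectInd₂ b t u) * ∑ t, ∑ u, rectInd b t u := by
  refine le_trans (le_of_eq ?_)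
    (sum_embedding_sum_le (rectInd₂ b) (rectInd b) (rectInd₂_nonneg b) (rectInd_nonneg b))
  exact card_sq_mul_expect_trans_perm
    (sumEmb (sumEmb (pairEmb k) (pairEmb l) (pairEmb_ne hkl)) (pairEmb h) (by
      rintro (a | a) c
      · exact pairEmb_ne hkh a c
      · exact pairEmb_ne hlh a c))
    (fun t u => rectInd₂ b (Function.Embedding.inl.trans t) (Function.Embedding.inl.trans u)
        * rectInd b (Function.Embedding.inr.trans t) (Function.Embedding.inr.trans u))

lemma card_embedding_mul_le (hn : 64 ≤ n) :
    (Fintype.card (Bool ⊕ Bool ↪ Fin n) : ℝ) * Fintype.card (Bool ↪ Fin n)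
      ≤ 2 * Fintype.card ((Bool ⊕ Bool) ⊕ Bool ↪ Fin n) := by
  have h : Fintype.card (Bool ⊕ Bool ↪ Fin n) * Fintype.card (Bool ↪ Fin n)
      ≤ 2 * Fintype.card ((Bool ⊕ Bool) ⊕ Bool ↪ Fin n) := by
    simp only [Fintype.card_embedding_eq, Fintype.card_sum, Fintype.card_bool, Fintype.card_fin]
    have h6 : n.descFactorial (2 + 2 + 2) = (n - 5) * ((n - 4) * n.descFactorial (2 + 2)) := by
      rw [Nat.descFactorial_succ, Nat.descFactorial_succ]
    have h2 : n.descFactorial 2 = (n - 1) * n := by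
      rw [Nat.descFactorial_succ, Nat.descFactorial_one]
    rw [h6, h2]
    obtain ⟨m, rfl⟩ := Nat.exists_eq_add_of_le hn
    have h3 : (64 + m - 1) * (64 + m) ≤ 2 * ((64 + m - 5) * (64 + m - 4)) := by
      rw [show 64 + m - 1 = 63 + m by omega, show 64 + m - 5 = 59 + m by omega,
        show 64 + m - 4 = 60 + m by omega]
      nlinarith
    calc _ ≤ (64 + m).descFactorial (2 + 2) * (2 * ((64 + m - 5) * (64 + m - 4))) := by gcongr
      _ = _ := by ring
  exact_mod_cast h

lemma card_embedding_pos (α : Type*) [Fintype α] (h : Fintype.card α ≤ n) :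
    (0 : ℝ) < Fintype.card (α ↪ Fin n) := by
  rw [Fintype.card_embedding_eq]
  exact_mod_cast Nat.descFactorial_pos.2 (by simpa using h)

/-- Disjoint rectangles are nearly independent for large `n`: dropping disjointness costs a factor 2
in the count of row choices and another 2 for columns. -/
lemma expect_pairInd_mul_mul_le (hn : 64 ≤ n) (b : Fin n → Fin n → ℤ) {k l h : Fin (n / 2)}
    (hkl : k ≠ l) (hkh : k ≠ h) (hlh : l ≠ h) :
    𝔼 ρ : Equiv.Perm (Fin n), 𝔼 σ : Equiv.Perm (Fin n),
      pairInd b ρ σ k * pairInd b ρ σ l * pairInd b ρ σ h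
      ≤ 4 * ((𝔼 ρ : Equiv.Perm (Fin n), 𝔼 σ : Equiv.Perm (Fin n), pairInd b ρ σ k * pairInd b ρ σ l)
        * 𝔼 ρ : Equiv.Perm (Fin n), 𝔼 σ : Equiv.Perm (Fin n), pairInd b ρ σ h) := by
  have h1 := card_mul_expect_pairInd_mul_mul_le b hkl hkh hlh
  rw [← card_mul_expect_pairInd_mul b hkl, ← card_mul_expect_pairInd b h] at h1
  have h2 := card_embedding_mul_le hn
  have h6 := card_embedding_pos (n := n) ((Bool ⊕ Bool) ⊕ Bool) (by simp; omega)
  have hnn : ∀ k, ∀ ρ σ : Equiv.Perm (Fin n), 0 ≤ pairInd b ρ σ k := fun k ρ σ =>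
    rectInd_nonneg _ _ _
  have hA : 0 ≤ 𝔼 ρ : Equiv.Perm (Fin n), 𝔼 σ : Equiv.Perm (Fin n),
      pairInd b ρ σ k * pairInd b ρ σ l :=
    Finset.expect_nonneg fun ρ _ => Finset.expect_nonneg fun σ _ => mul_nonneg (hnn _ _ _) (hnn _ _ _)
  have hB : 0 ≤ 𝔼 ρ : Equiv.Perm (Fin n), 𝔼 σ : Equiv.Perm (Fin n), pairInd b ρ σ h :=
    Finset.expect_nonneg fun ρ _ => Finset.expect_nonneg fun σ _ => hnn _ _ _
  set A := 𝔼 ρ : Equiv.Perm (Fin n), 𝔼 σ : Equiv.Perm (Fin n), pairInd b ρ σ k * pairInd b ρ σ l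
  set B := 𝔼 ρ : Equiv.Perm (Fin n), 𝔼 σ : Equiv.Perm (Fin n), pairInd b ρ σ h
  set c4 : ℝ := (Fintype.card (Bool ⊕ Bool ↪ Fin n) : ℝ)
  set c2 : ℝ := (Fintype.card (Bool ↪ Fin n) : ℝ)
  set c6 : ℝ := (Fintype.card ((Bool ⊕ Bool) ⊕ Bool ↪ Fin n) : ℝ)
  have h0 : 0 ≤ c4 * c2 := mul_nonneg (Nat.cast_nonneg _) (Nat.cast_nonneg _)
  refine le_of_mul_le_mul_left ?_ (pow_pos h6 2)
  refine h1.trans ?_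
  calc c4 ^ 2 * A * (c2 ^ 2 * B) = (c4 * c2) ^ 2 * (A * B) := by ring
    _ ≤ (2 * c6) ^ 2 * (A * B) := by gcongr
    _ = _ := by ring

section CloseToBoolean

variable {b : Fin n → Fin n → ℤ} {ε : ℝ}

lemma expect_sum_pairInd_le
    (h : mean (fun π => distBool (lin (fun i j => (b i j : ℝ)) π) ^ 2) ≤ ε) :
    𝔼 ρ : Equiv.Perm (Fin n), 𝔼 σ : Equiv.Perm (Fin n), ∑ k, pairInd b ρ σ k ≤ 1 + 3072 * ε := by
  calc _ ≤ 𝔼 ρ : Equiv.Perm (Fin n), 𝔼 σ : Equiv.Perm (Fin n),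
        (1 + 3072 * pairDist (fun i j => (b i j : ℝ)) ρ σ) :=
        Finset.expect_le_expect fun ρ _ => Finset.expect_le_expect fun σ _ => sum_pairInd_le b ρ σ
    _ = 1 + 3072 * mean (fun π => distBool (lin (fun i j => (b i j : ℝ)) π) ^ 2) := by
        simp only [Finset.expect_add_distrib, Fintype.expect_const, ← Finset.mul_expect,
          expect_pairDist]
    _ ≤ _ := by gcongr

lemma half_mul_sum_rectInd_le
    (h : mean (fun π => distBool (lin (fun i j => (b i j : ℝ)) π) ^ 2) ≤ ε) :
    ((n / 2 : ℕ) : ℝ) * ∑ t, ∑ u, rectInd b t u ≤ (n * (n - 1)) ^ 2 * (1 + 3072 * ε) := by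
  have h1 := expect_sum_pairInd_le h
  simp only [Finset.expect_sum_comm] at h1
  have h2 : ((n / 2 : ℕ) : ℝ) * ∑ t, ∑ u, rectInd b t u = (n * (n - 1)) ^ 2 *
      ∑ k, 𝔼 ρ : Equiv.Perm (Fin n), 𝔼 σ : Equiv.Perm (Fin n), pairInd b ρ σ k := by
    rw [Finset.mul_sum (s := (univ : Finset (Fin (n / 2)))), ← card_bool_embedding,
      Finset.sum_congr rfl fun k _ => card_mul_expect_pairInd b k]
    simp
  rw [h2]
  gcongr

/-- Few pairs of disjoint rectangles are both nonzero. -/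
lemma mul_sum_rectInd₂_le (hn : 64 ≤ n)
    (h : mean (fun π => distBool (lin (fun i j => (b i j : ℝ)) π) ^ 2) ≤ ε)
    (hε : 3072 * ε ≤ 1) :
    ((n / 2 : ℕ) : ℝ) * ((n / 2 : ℕ) - 1) * ∑ t, ∑ u, rectInd₂ b t u ≤ 36864 * ε * n ^ 8 := by
  set m := n / 2 with hm
  have hI : ∀ ρ σ : Equiv.Perm (Fin n), ∀ k, pairInd b ρ σ k * pairInd b ρ σ k = pairInd b ρ σ k :=
    fun ρ σ k => rectInd_sq _ _ _
  set A : Fin m → Fin m → ℝ := fun k l => 𝔼 ρ : Equiv.Perm (Fin n), 𝔼 σ : Equiv.Perm (Fin n),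
    pairInd b ρ σ k * pairInd b ρ σ l with hA
  set B : Fin m → ℝ := fun k => 𝔼 ρ : Equiv.Perm (Fin n), 𝔼 σ : Equiv.Perm (Fin n),
    pairInd b ρ σ k with hB
  set T : Fin m → Fin m → Fin m → ℝ := fun k l h => 𝔼 ρ : Equiv.Perm (Fin n),
    𝔼 σ : Equiv.Perm (Fin n), pairInd b ρ σ k * pairInd b ρ σ l * pairInd b ρ σ h with hT
  have hnn : ∀ k, ∀ ρ σ : Equiv.Perm (Fin n), 0 ≤ pairInd b ρ σ k := fun k ρ σ =>
    rectInd_nonneg _ _ _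
  have hA0 : ∀ k l, 0 ≤ A k l := fun k l => Finset.expect_nonneg fun ρ _ =>
    Finset.expect_nonneg fun σ _ => mul_nonneg (hnn _ _ _) (hnn _ _ _)
  have hB0 : ∀ k, 0 ≤ B k := fun k => Finset.expect_nonneg fun ρ _ =>
    Finset.expect_nonneg fun σ _ => hnn _ _ _
  have hBsum : ∑ k, B k ≤ 2 := by
    have h1 := expect_sum_pairInd_le h
    simp only [Finset.expect_sum_comm] at h1
    exact h1.trans (by linarith)
  set P2 := ∑ k, ∑ l ∈ univ.erase k, A k l with hP2
  set P3 := ∑ k, ∑ l ∈ univ.erase k, ∑ h ∈ (univ.erase k).erase l, T k l h with hP3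
  have hP20 : 0 ≤ P2 := Finset.sum_nonneg fun k _ => Finset.sum_nonneg fun l _ => hA0 k l
  have hP3le : P3 ≤ 8 * P2 := by
    rw [hP3, hP2, Finset.mul_sum]
    refine Finset.sum_le_sum fun k _ => ?_
    rw [Finset.mul_sum]
    refine Finset.sum_le_sum fun l hl => ?_
    calc ∑ h ∈ (univ.erase k).erase l, T k l h
        ≤ ∑ h ∈ (univ.erase k).erase l, 4 * (A k l * B h) := by
          refine Finset.sum_le_sum fun h hh => ?_
          simp only [Finset.mem_erase, Finset.mem_univ, and_true] at hl hh
          exact expect_pairInd_mul_mul_le hn b hl.symm hh.2.symm hh.1.symm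
      _ ≤ ∑ h, 4 * (A k l * B h) := Finset.sum_le_univ_sum_of_nonneg fun h =>
          mul_nonneg (by norm_num) (mul_nonneg (hA0 k l) (hB0 h))
      _ = 4 * A k l * ∑ h, B h := by
          rw [Finset.mul_sum]; exact Finset.sum_congr rfl fun _ _ => by ring
      _ ≤ 4 * A k l * 2 := by have := hA0 k l; gcongr
      _ = 8 * A k l := by ring
  have hpt : ∀ ρ σ : Equiv.Perm (Fin n),
      (∑ k, ∑ l ∈ univ.erase k, pairInd b ρ σ k * pairInd b ρ σ l)
      - (∑ k, ∑ l ∈ univ.erase k, ∑ h ∈ (univ.erase k).erase l,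
          pairInd b ρ σ k * pairInd b ρ σ l * pairInd b ρ σ h) / 16
      ≤ 6 * (3072 * pairDist (fun i j => (b i j : ℝ)) ρ σ) := by
    intro ρ σ
    rw [sum_erase_mul (hI ρ σ), sum_erase_erase_mul (hI ρ σ)]
    have h1 := sum_pairInd_le b ρ σ
    obtain ⟨N, hN⟩ := exists_nat_eq_sum_pairInd b ρ σ
    rw [hN] at h1 ⊢
    exact falling_sub_le N (mul_nonneg (by norm_num) (pairDist_nonneg _ _ _)) h1
  have hmain : P2 - P3 / 16 ≤ 18432 * ε := by
    have h1 := Finset.expect_le_expect (s := univ) fun (ρ : Equiv.Perm (Fin n)) _ =>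
      Finset.expect_le_expect (s := univ) fun (σ : Equiv.Perm (Fin n)) _ => hpt ρ σ
    simp only [Finset.expect_sub_distrib, ← Finset.expect_div, Finset.expect_sum_comm,
      ← Finset.mul_expect, expect_pairDist] at h1
    linarith
  -- As `P3` is at most `8 * P2`, subtracting a sixteenth of it leaves at least half of `P2`.
  have hP2le : P2 ≤ 36864 * ε := by linarith
  set c : ℝ := (Fintype.card (Bool ⊕ Bool ↪ Fin n) : ℝ) with hc
  have hAval : ∀ k, ∀ l ∈ univ.erase k, c ^ 2 * A k l = ∑ t, ∑ u, rectInd₂ b t u := by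
    intro k l hl
    exact card_mul_expect_pairInd_mul b (Finset.ne_of_mem_erase hl).symm
  have hP2eq : c ^ 2 * P2 = (m : ℝ) * (m - 1) * ∑ t, ∑ u, rectInd₂ b t u := by
    have hm1 : 1 ≤ m := by omega
    simp only [hP2, Finset.mul_sum _ _ (c ^ 2)]
    rw [Finset.sum_congr rfl fun k _ => Finset.sum_congr rfl fun l hl => hAval k l hl]
    simp only [Finset.sum_const, Finset.card_erase_of_mem (Finset.mem_univ _), Finset.card_univ,
      Fintype.card_fin, nsmul_eq_mul]
    rw [Nat.cast_sub hm1]; push_cast; ring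
  have hcle : c ≤ n ^ 4 := by
    have : Fintype.card (Bool ⊕ Bool ↪ Fin n) ≤ n ^ 4 := by
      rw [Fintype.card_embedding_eq]
      simpa using Nat.descFactorial_le_pow n 4
    rw [hc]; exact_mod_cast this
  have hc0 : 0 ≤ c := Nat.cast_nonneg _
  rw [← hP2eq]
  calc c ^ 2 * P2 ≤ ((n : ℝ) ^ 4) ^ 2 * (36864 * ε) := by gcongr
    _ = _ := by ring

end CloseToBoolean

/-! ### Sparsest representatives and nonzero rectangles through an entry -/

/-- The positions of the nonzero entries of a matrix. -/
def matSupport (d : Fin n → Fin n → ℤ) : Finset (Fin n × Fin n) :=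
  univ.filter fun x => d x.1 x.2 ≠ 0

/-- No matrix with the same rectangles as `d` has fewer nonzero entries. -/
def IsReduced (d : Fin n → Fin n → ℤ) : Prop :=
  ∀ u w : Fin n → ℤ, #(matSupport d) ≤ #(matSupport fun i j => d i j - u i - w j)

lemma exists_isReduced (b : Fin n → Fin n → ℤ) :
    ∃ u w : Fin n → ℤ, IsReduced (fun i j => b i j - u i - w j) ∧
      ∀ u' w' : Fin n → ℤ, #(matSupport fun i j => b i j - u i - w j)
        ≤ #(matSupport fun i j => b i j - u' i - w' j) := by
  obtain ⟨⟨u, w⟩, _, h⟩ := WellFounded.has_min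
    (measure fun p : (Fin n → ℤ) × (Fin n → ℤ) =>
      #(matSupport fun i j => b i j - p.1 i - p.2 j)).wf Set.univ ⟨(0, 0), trivial⟩
  have hmin : ∀ u' w' : Fin n → ℤ, #(matSupport fun i j => b i j - u i - w j)
        ≤ #(matSupport fun i j => b i j - u' i - w' j) := fun u' w' =>
    not_lt.1 (h (u', w') trivial)
  refine ⟨u, w, fun u' w' => ?_, hmin⟩
  refine (hmin (u + u') (w + w')).trans (le_of_eq ?_)
  congr 2
  funext i j
  simp only [Pi.add_apply]; ring

lemma card_matSupport (d : Fin n → Fin n → ℤ) :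
    #(matSupport d) = ∑ i, #(univ.filter fun j => d i j ≠ 0) := by
  simp only [matSupport, Finset.card_filter, Fintype.sum_prod_type]

lemma card_matSupport_transpose (d : Fin n → Fin n → ℤ) :
    #(matSupport fun i j => d j i) = #(matSupport d) := by
  simp only [matSupport, Finset.card_filter, Fintype.sum_prod_type]
  rw [Finset.sum_comm]

lemma IsReduced.transpose {d : Fin n → Fin n → ℤ} (hd : IsReduced d) :
    IsReduced fun i j => d j i := by
  intro u w
  rw [card_matSupport_transpose]
  refine (hd w u).trans (le_of_eq ?_)
  rw [← card_matSupport_transpose]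
  congr 2
  funext i j
  ring

/-- Subtracting `t` from row `i` turns the entries equal to `t` into zeros and the zeros into
nonzeros. By minimality the zeros are at least as many as the entries equal to `t`. -/
lemma IsReduced.two_mul_card_row_le {d : Fin n → Fin n → ℤ} (hd : IsReduced d) (i : Fin n) {t : ℤ}
    (ht : t ≠ 0) : 2 * #(univ.filter fun j => d i j = t) ≤ n := by
  have h := hd (fun x => if x = i then t else 0) (fun _ => 0)
  rw [card_matSupport, card_matSupport, ← Finset.add_sum_erase _ _ (Finset.mem_univ i),
    ← Finset.add_sum_erase univ (fun x => #(univ.filter fun j =>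
      d x j - (if x = i then t else 0) - 0 ≠ 0)) (Finset.mem_univ i)] at h
  have h1 : ∑ x ∈ univ.erase i, #(univ.filter fun j => d x j - (if x = i then t else 0) - 0 ≠ 0)
      = ∑ x ∈ univ.erase i, #(univ.filter fun j => d x j ≠ 0) := by
    refine Finset.sum_congr rfl fun x hx => ?_
    simp only [if_neg (Finset.ne_of_mem_erase hx), sub_zero]
  rw [h1] at h
  have h2 : #(univ.filter fun j => d i j ≠ 0) ≤ #(univ.filter fun j => ¬ d i j = t) := by
    have := Nat.le_of_add_le_add_right h
    simpa [sub_eq_zero] using this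
  have h3 : #(univ.filter fun j => d i j = t) ≤ #(univ.filter fun j => d i j ≠ 0) :=
    Finset.card_le_card fun j hj => by
      simp only [Finset.mem_filter, Finset.mem_univ, true_and] at hj ⊢
      rw [hj]; exact ht
  have h4 := Finset.card_filter_add_card_filter_not (s := (univ : Finset (Fin n)))
    (fun j => d i j = t)
  rw [Finset.card_univ, Fintype.card_fin] at h4
  omega

lemma IsReduced.two_mul_card_col_le {d : Fin n → Fin n → ℤ} (hd : IsReduced d) (j : Fin n) {t : ℤ}
    (ht : t ≠ 0) : 2 * #(univ.filter fun i => d i j = t) ≤ n :=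
  hd.transpose.two_mul_card_row_le j ht

/-- The opposite corners completing `s` to a nonzero rectangle. -/
def corners (d : Fin n → Fin n → ℤ) (s : Fin n × Fin n) : Finset (Fin n × Fin n) :=
  univ.filter fun w => rect d s.1 w.1 s.2 w.2 ≠ 0

/-- For s = (i, j), at least half of the columns y have d i y ≠ d i j, and for each of them at least
half of the rows x have d x j ≠ d i j - d i y. At such a cell (x, y) the rectangle is nonzero unless
d x y ≠ 0, which the support term accounts for. -/
lemma IsReduced.sq_le_card_corners {d : Fin n → Fin n → ℤ} (hd : IsReduced d)
    {s : Fin n × Fin n} (hs : s ∈ matSupport d) :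
    n ^ 2 ≤ 4 * (#(corners d s) + #(matSupport d)) := by
  obtain ⟨i, j⟩ := s
  have hij : d i j ≠ 0 := by simpa [matSupport] using hs
  have hle : n ≤ 2 * #(univ.filter fun y => ¬ d i y = d i j) := by
    have h1 := hd.two_mul_card_row_le i hij
    have h2 := Finset.card_filter_add_card_filter_not (s := (univ : Finset (Fin n)))
      (fun y => d i y = d i j)
    rw [Finset.card_univ, Fintype.card_fin] at h2
    omega
  have hcol : ∀ y ∈ univ.filter (fun y => ¬ d i y = d i j),
      n ≤ 2 * #(univ.filter fun x => ¬ d x j = d i j - d i y) := by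
    intro y hy
    have hy' : d i j - d i y ≠ 0 := sub_ne_zero.2 fun h => (Finset.mem_filter.1 hy).2 h.symm
    have h1 := hd.two_mul_card_col_le j hy'
    have h2 := Finset.card_filter_add_card_filter_not (s := (univ : Finset (Fin n)))
      (fun x => d x j = d i j - d i y)
    rw [Finset.card_univ, Fintype.card_fin] at h2
    omega
  set V : Finset (Fin n × Fin n) := univ.filter fun w => ¬ d w.1 j = d i j - d i w.2 with hV
  have hVcard : #V = ∑ y, #(univ.filter fun x => ¬ d x j = d i j - d i y) := by
    simp only [hV, Finset.card_filter, Fintype.sum_prod_type]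
    rw [Finset.sum_comm]
  have hV4 : n ^ 2 ≤ 4 * #V := by
    have h1 : ∑ _y ∈ univ.filter (fun y => ¬ d i y = d i j), n
        ≤ ∑ y ∈ univ.filter (fun y => ¬ d i y = d i j),
          2 * #(univ.filter fun x => ¬ d x j = d i j - d i y) := Finset.sum_le_sum hcol
    have h2 : ∑ y ∈ univ.filter (fun y => ¬ d i y = d i j),
          2 * #(univ.filter fun x => ¬ d x j = d i j - d i y) ≤ 2 * #V := by
      rw [hVcard, Finset.mul_sum]
      exact Finset.sum_le_univ_sum_of_nonneg fun _ => Nat.zero_le _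
    rw [Finset.sum_const, smul_eq_mul] at h1
    nlinarith
  have hsub : V ⊆ corners d (i, j) ∪ matSupport d := by
    rintro ⟨x, y⟩ hxy
    simp only [hV, Finset.mem_filter, Finset.mem_univ, true_and] at hxy
    rw [Finset.mem_union]
    by_contra hc
    rw [not_or] at hc
    simp only [corners, matSupport, Finset.mem_filter, Finset.mem_univ, true_and,
      not_not] at hc
    simp only [rect] at hc
    exact hxy (by linarith)
  have := (Finset.card_le_card hsub).trans (Finset.card_union_le _ _)
  omega

/-- Entries of `S` in a different row and a different column from `s`. -/
def disjointFrom (S : Finset (Fin n × Fin n)) (s : Fin n × Fin n) : Finset (Fin n × Fin n) :=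
  S.filter fun x => x.1 ≠ s.1 ∧ x.2 ≠ s.2

lemma card_le_card_disjointFrom_add (S : Finset (Fin n × Fin n)) (s : Fin n × Fin n) :
    #S ≤ #(disjointFrom S s) + 2 * n := by
  have hsub : S ⊆ disjointFrom S s ∪ (({s.1} : Finset (Fin n)) ×ˢ univ ∪ univ ×ˢ {s.2}) := by
    intro x hx
    simp only [disjointFrom, Finset.mem_union, Finset.mem_filter, Finset.mem_product,
      Finset.mem_singleton, Finset.mem_univ, and_true, true_and]
    tauto
  have h1 := (Finset.card_le_card hsub).trans (Finset.card_union_le _ _)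
  have h2 := Finset.card_union_le (({s.1} : Finset (Fin n)) ×ˢ (univ : Finset (Fin n)))
    ((univ : Finset (Fin n)) ×ˢ {s.2})
  simp only [Finset.card_product, Finset.card_singleton, Finset.card_univ, Fintype.card_fin] at h2
  omega

/-- Four distinct points as an embedding. -/
def fourEmb {X : Type*} (a b c e : X) (h : a ≠ b ∧ c ≠ e ∧ a ≠ c ∧ a ≠ e ∧ b ≠ c ∧ b ≠ e) :
    Bool ⊕ Bool ↪ X :=
  ⟨Sum.elim (fun x => if x then b else a) (fun x => if x then e else c), by
    obtain ⟨h1, h2, h3, h4, h5, h6⟩ := h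
    rintro (x | x) (y | y) hxy <;> cases x <;> cases y <;> simp_all [eq_comm]⟩

/-- Pairs of corners completing two entries to two disjoint nonzero rectangles. -/
def cornerPairs (d : Fin n → Fin n → ℤ) (p : (Fin n × Fin n) × (Fin n × Fin n)) :
    Finset ((Fin n × Fin n) × (Fin n × Fin n)) :=
  univ.filter fun q => q.1 ∈ disjointFrom (corners d p.1) p.2 ∧
    q.2 ∈ disjointFrom (disjointFrom (corners d p.2) p.1) q.1

lemma card_filter_mem_and_mem {α β : Type*} [Fintype α] [Fintype β] [DecidableEq α]
    [DecidableEq β] (A : Finset α) (B : α → Finset β) :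
    #(univ.filter fun q : α × β => q.1 ∈ A ∧ q.2 ∈ B q.1) = ∑ a ∈ A, #(B a) := by
  rw [← Finset.card_sigma]
  exact Finset.card_bij' (fun q _ => ⟨q.1, q.2⟩) (fun x _ => (x.1, x.2)) (by simp) (by simp)
    (by simp) (by simp)

/-- Avoiding the row and column of one cell discards at most `2 * n` cells. The first corner avoids
one cell; the second avoids two, one of them the first corner. -/
lemma mul_le_card_cornerPairs (d : Fin n → Fin n → ℤ) (p : (Fin n × Fin n) × (Fin n × Fin n)) :
    (#(corners d p.1) - 2 * n) * (#(corners d p.2) - 4 * n) ≤ #(cornerPairs d p) := by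
  unfold cornerPairs
  rw [card_filter_mem_and_mem (disjointFrom (corners d p.1) p.2)
    fun w => disjointFrom (disjointFrom (corners d p.2) p.1) w]
  have h1 := card_le_card_disjointFrom_add (corners d p.1) p.2
  have h2 := card_le_card_disjointFrom_add (corners d p.2) p.1
  calc _ ≤ #(disjointFrom (corners d p.1) p.2) * (#(corners d p.2) - 4 * n) := by
        gcongr; omega
    _ = ∑ w ∈ disjointFrom (corners d p.1) p.2, (#(corners d p.2) - 4 * n) := by simp
    _ ≤ _ := Finset.sum_le_sum fun w _ => by
        have h3 := card_le_card_disjointFrom_add (disjointFrom (corners d p.2) p.1) w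
        omega

/-- The pairs of entries of `S` lying in different rows and different columns. -/
def disjointPairs (S : Finset (Fin n × Fin n)) : Finset ((Fin n × Fin n) × (Fin n × Fin n)) :=
  (S ×ˢ S).filter fun p => p.2 ∈ disjointFrom S p.1

lemma card_disjointPairs (S : Finset (Fin n × Fin n)) :
    #(disjointPairs S) = ∑ s ∈ S, #(disjointFrom S s) := by
  unfold disjointPairs
  rw [Finset.card_filter, Finset.sum_product]
  refine Finset.sum_congr rfl fun s _ => ?_
  rw [← Finset.card_filter]
  congr 1
  ext x
  simp only [disjointFrom, Finset.mem_filter]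
  tauto

/-- Two entries and their opposite corners are the vertices of two nonzero rectangles, and can be
read off from them. A nonzero rectangle is nondegenerate, which supplies the distinctness not built
into `cornerPairs`. -/
lemma sum_card_cornerPairs_le (d : Fin n → Fin n → ℤ) (S : Finset (Fin n × Fin n)) :
    (∑ p ∈ disjointPairs S, (#(cornerPairs d p) : ℝ)) ≤ ∑ t, ∑ u, rectInd₂ d t u := by
  have h1 : ∑ t, ∑ u, rectInd₂ d t u
      = #(univ.filter fun x : (Bool ⊕ Bool ↪ Fin n) × (Bool ⊕ Bool ↪ Fin n) =>
        embRect d (Function.Embedding.inl.trans x.1) (Function.Embedding.inl.trans x.2) ≠ 0 ∧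
        embRect d (Function.Embedding.inr.trans x.1) (Function.Embedding.inr.trans x.2) ≠ 0) := by
    rw [Finset.card_filter, Fintype.sum_prod_type]
    push_cast
    refine Finset.sum_congr rfl fun t _ => Finset.sum_congr rfl fun u _ => ?_
    unfold rectInd₂ rectInd
    split_ifs <;> simp_all
  rw [h1, ← Nat.cast_sum, ← Finset.card_sigma]
  norm_cast
  have hmem : ∀ x ∈ (disjointPairs S).sigma (cornerPairs d),
      (x.1.1.1 ≠ x.2.1.1 ∧ x.1.2.1 ≠ x.2.2.1 ∧ x.1.1.1 ≠ x.1.2.1 ∧ x.1.1.1 ≠ x.2.2.1 ∧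
        x.2.1.1 ≠ x.1.2.1 ∧ x.2.1.1 ≠ x.2.2.1) ∧
      (x.1.1.2 ≠ x.2.1.2 ∧ x.1.2.2 ≠ x.2.2.2 ∧ x.1.1.2 ≠ x.1.2.2 ∧ x.1.1.2 ≠ x.2.2.2 ∧
        x.2.1.2 ≠ x.1.2.2 ∧ x.2.1.2 ≠ x.2.2.2) ∧
      rect d x.1.1.1 x.2.1.1 x.1.1.2 x.2.1.2 ≠ 0 ∧ rect d x.1.2.1 x.2.2.1 x.1.2.2 x.2.2.2 ≠ 0 := by
    rintro ⟨⟨⟨i, j⟩, ⟨i', j'⟩⟩, ⟨⟨x, y⟩, ⟨x', y'⟩⟩⟩ hx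
    simp only [Finset.mem_sigma, disjointPairs, cornerPairs, disjointFrom, corners,
      Finset.mem_filter, Finset.mem_univ, true_and, Finset.mem_product] at hx ⊢
    obtain ⟨⟨_, _, h1, h2⟩, ⟨h3, h4, h5⟩, ⟨h6, h7, h8⟩, h9, h10⟩ := hx
    refine ⟨⟨?_, ?_, h1.symm, h7.symm, h4, h9.symm⟩, ⟨?_, ?_, h2.symm, h8.symm, h5, h10.symm⟩,
      h3, h6⟩
    · rintro rfl; exact h3 (by simp [rect])
    · rintro rfl; exact h6 (by simp [rect])
    · rintro rfl; exact h3 (by simp [rect])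
    · rintro rfl; exact h6 (by simp [rect])
  refine Finset.card_le_card_of_surjOn
    (fun x => ⟨((x.1 (Sum.inl false), x.2 (Sum.inl false)), (x.1 (Sum.inr false), x.2 (Sum.inr false))),
      ((x.1 (Sum.inl true), x.2 (Sum.inl true)), (x.1 (Sum.inr true), x.2 (Sum.inr true)))⟩) ?_
  intro x hx
  obtain ⟨h2, h3, h4, h5⟩ := hmem x hx
  refine ⟨(fourEmb _ _ _ _ h2, fourEmb _ _ _ _ h3), ?_, rfl⟩
  rw [Finset.mem_coe, Finset.mem_filter]
  exact ⟨Finset.mem_univ _, h4, h5⟩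

lemma le_of_third_le_of_mul_le {x m S ε : ℝ} (hx : 64 ≤ x) (hm : x / 3 ≤ m) (hS : 0 ≤ S)
    (h : m * S ≤ (x * (x - 1)) ^ 2 * (1 + 3072 * ε)) (hε : 3072 * ε ≤ 1) :
    S ≤ x ^ 2 * (6 * x) := by
  refine le_of_mul_le_mul_left ?_ (show (0 : ℝ) < x / 3 by linarith)
  have h1 : x * (x - 1) ≤ x * x := by nlinarith
  have h2 : 0 ≤ x * (x - 1) := mul_nonneg (by linarith) (by linarith)
  calc x / 3 * S ≤ m * S := mul_le_mul_of_nonneg_right hm hS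
    _ ≤ (x * (x - 1)) ^ 2 * (1 + 3072 * ε) := h
    _ ≤ (x * (x - 1)) ^ 2 * 2 := mul_le_mul_of_nonneg_left (by linarith) (sq_nonneg _)
    _ ≤ (x * x) ^ 2 * 2 := by gcongr
    _ = _ := by ring

lemma le_of_mul_pow_four_le {x m Q P ε : ℝ} (hx : 64 ≤ x) (hm : x / 3 ≤ m) (hQ : 0 ≤ Q)
    (h : P * (x ^ 4 / 200) ≤ Q) (h' : m * (m - 1) * Q ≤ 36864 * ε * x ^ 8) (hε : 0 ≤ ε) :
    P ≤ 100000000 * ε * x ^ 2 := by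
  have h1 : x ^ 2 / 12 ≤ m * (m - 1) := by nlinarith
  refine le_of_mul_le_mul_left ?_ (show (0 : ℝ) < x ^ 6 / 2400 by positivity)
  calc x ^ 6 / 2400 * P = x ^ 2 / 12 * (P * (x ^ 4 / 200)) := by ring
    _ ≤ x ^ 2 / 12 * Q := by gcongr
    _ ≤ m * (m - 1) * Q := mul_le_mul_of_nonneg_right h1 hQ
    _ ≤ 36864 * ε * x ^ 8 := h'
    _ ≤ 100000000 / 2400 * ε * x ^ 8 := by gcongr; norm_num
    _ = x ^ 6 / 2400 * (100000000 * ε * x ^ 2) := by ring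

/-- On average at most 2 of about n/2 rectangles are nonzero, so there are O(n³) nonzero rectangles
in all. Some base cell therefore lies opposite to O(n) nonzero ones, and these are the nonzero
entries after normalising at it. -/
lemma exists_card_matSupport_le (hn : 64 ≤ n) {b : Fin n → Fin n → ℤ} {ε : ℝ}
    (h : mean (fun π => distBool (lin (fun i j => (b i j : ℝ)) π) ^ 2) ≤ ε)
    (hε : 3072 * ε ≤ 1) :
    ∃ u w : Fin n → ℤ, #(matSupport fun i j => b i j - u i - w j) ≤ 6 * n := by
  have hn' : (64 : ℝ) ≤ n := by exact_mod_cast hn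
  have hm : (n : ℝ) / 3 ≤ ((n / 2 : ℕ) : ℝ) := by
    have : n ≤ 3 * (n / 2) := by omega
    have : (n : ℝ) ≤ 3 * ((n / 2 : ℕ) : ℝ) := by exact_mod_cast this
    linarith
  set F : ℤ → ℝ := fun x => if x ≠ 0 then 1 else 0 with hF
  have hF0 : ∀ x, 0 ≤ F x := fun x => by simp only [hF]; split_ifs <;> norm_num
  have h1 := half_mul_sum_rectInd_le h
  have hS : ∑ t, ∑ u, rectInd b t u = ∑ i, ∑ i', ∑ j, ∑ j', F (rect b i i' j j') :=
    sum_sum_embRect F (by simp [hF]) b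
  rw [hS] at h1
  set S := ∑ i, ∑ i', ∑ j, ∑ j', F (rect b i i' j j')
  have hS0 : 0 ≤ S := Finset.sum_nonneg fun _ _ => Finset.sum_nonneg fun _ _ =>
    Finset.sum_nonneg fun _ _ => Finset.sum_nonneg fun _ _ => hF0 _
  have h2 : S ≤ n ^ 2 * (6 * n) := le_of_third_le_of_mul_le hn' hm hS0 h1 hε
  obtain ⟨i₀, j₀, h3⟩ := exists_base_le (by omega) h2
  refine ⟨fun i => b i j₀ - b i₀ j₀, fun j => b i₀ j, ?_⟩
  have h5 : (#(matSupport fun i j => b i j - (b i j₀ - b i₀ j₀) - b i₀ j) : ℝ)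
      = ∑ i, ∑ j, F (rect b i i₀ j j₀) := by
    unfold matSupport
    rw [Finset.card_filter, Fintype.sum_prod_type]
    push_cast
    refine Finset.sum_congr rfl fun i _ => Finset.sum_congr rfl fun j _ => ?_
    have : rect b i i₀ j j₀ = b i j - (b i j₀ - b i₀ j₀) - b i₀ j := by unfold rect; ring
    rw [this]
  rw [← h5] at h3
  exact_mod_cast h3

/-- A linear function with integer coefficients close to Boolean has, after normalisation, few pairs
of disjoint nonzero coefficients. -/
lemma exists_normalisation (hn : 64 ≤ n) {b : Fin n → Fin n → ℤ} {ε : ℝ}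
    (h : mean (fun π => distBool (lin (fun i j => (b i j : ℝ)) π) ^ 2) ≤ ε)
    (hε : 3072 * ε ≤ 1) :
    ∃ (d : Fin n → Fin n → ℤ) (k : ℤ),
      (∀ π : Equiv.Perm (Fin n), ∑ i, b i (π i) = k + ∑ i, d i (π i)) ∧
      (#(disjointPairs (matSupport d)) : ℝ) ≤ 100000000 * ε * n ^ 2 := by
  have hn' : (64 : ℝ) ≤ n := by exact_mod_cast hn
  obtain ⟨u, w, hred, hmin⟩ := exists_isReduced b
  set d : Fin n → Fin n → ℤ := fun i j => b i j - u i - w j with hd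
  have hrect : ∀ i i' j j', rect d i i' j j' = rect b i i' j j' := fun i i' j j' => by
    simp only [hd, rect]; ring
  have hm : (n : ℝ) / 3 ≤ ((n / 2 : ℕ) : ℝ) := by
    have : n ≤ 3 * (n / 2) := by omega
    have : (n : ℝ) ≤ 3 * ((n / 2 : ℕ) : ℝ) := by exact_mod_cast this
    linarith
  have hsupp : #(matSupport d) ≤ 6 * n := by
    obtain ⟨u', w', h1⟩ := exists_card_matSupport_le hn h hε
    exact (hmin u' w').trans h1
  have hcorner : ∀ s ∈ matSupport d, n ^ 2 ≤ 8 * #(corners d s) := by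
    intro s hs
    have h1 := hred.sq_le_card_corners hs
    nlinarith
  have hpairs : ∀ p ∈ disjointPairs (matSupport d), (n : ℝ) ^ 4 / 200 ≤ #(cornerPairs d p) := by
    intro p hp
    simp only [disjointPairs, Finset.mem_filter, Finset.mem_product] at hp
    have h1 := hcorner p.1 hp.1.1
    have h2 := hcorner p.2 hp.1.2
    have h3 := mul_le_card_cornerPairs d p
    -- From n²/8 corners, at most 2n ≤ n²/32 are lost here and 4n ≤ n²/16 in the next bound; 11 · 16
    -- = 176 gives the 200.
    have h4 : n ^ 2 ≤ 11 * (#(corners d p.1) - 2 * n) := by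
      have : 64 * n ≤ n ^ 2 := by nlinarith
      omega
    have h5 : n ^ 2 ≤ 16 * (#(corners d p.2) - 4 * n) := by
      have : 64 * n ≤ n ^ 2 := by nlinarith
      omega
    have h6 : n ^ 4 ≤ 200 * #(cornerPairs d p) := by
      calc n ^ 4 = n ^ 2 * n ^ 2 := by ring
        _ ≤ (11 * (#(corners d p.1) - 2 * n)) * (16 * (#(corners d p.2) - 4 * n)) := by gcongr
        _ = 176 * ((#(corners d p.1) - 2 * n) * (#(corners d p.2) - 4 * n)) := by ring
        _ ≤ 176 * #(cornerPairs d p) := by gcongr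
        _ ≤ _ := by omega
    have h7 : (n : ℝ) ^ 4 ≤ 200 * #(cornerPairs d p) := by exact_mod_cast h6
    linarith
  refine ⟨d, ∑ i, u i + ∑ j, w j, fun π => ?_, ?_⟩
  · have := Equiv.sum_comp π w
    simp only [hd, Finset.sum_sub_distrib, this]
    ring
  have hε0 : 0 ≤ ε := (mean_nonneg fun π => sq_nonneg _).trans h
  have hE : embRect d = embRect b := funext fun t => funext fun u => hrect _ _ _ _
  have hR : ∀ t u, rectInd₂ d t u = rectInd₂ b t u := fun t u => by
    unfold rectInd₂ rectInd
    rw [hE]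
  have h1 := sum_card_cornerPairs_le d (matSupport d)
  simp only [hR] at h1
  have h2 := mul_sum_rectInd₂_le hn h hε
  have h3 : (#(disjointPairs (matSupport d)) : ℝ) * (n ^ 4 / 200) ≤ ∑ t, ∑ u, rectInd₂ b t u := by
    refine le_trans ?_ h1
    rw [← nsmul_eq_mul, ← Finset.sum_const]
    exact Finset.sum_le_sum hpairs
  exact le_of_mul_pow_four_le hn' hm (Finset.sum_nonneg fun _ _ => Finset.sum_nonneg fun _ _ =>
    rectInd₂_nonneg _ _ _) h3 h2 hε0

/-! ### Few disjoint pairs force a line -/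

/-- A set of cells with few pairs in different rows and columns lies mostly on one line. -/
lemma exists_line {S : Finset (Fin n × Fin n)} (hS : S.Nonempty)
    (h : 100 * #(disjointPairs S) ≤ #S ^ 2) :
    (∃ i, #(S.filter fun x => x.1 ≠ i) * #S ≤ 4 * #(disjointPairs S)) ∨
      ∃ j, #(S.filter fun x => x.2 ≠ j) * #S ≤ 4 * #(disjointPairs S) := by
  set P := #(disjointPairs S) with hP
  have hPsum := card_disjointPairs S
  obtain ⟨s, hs, hsle⟩ : ∃ s ∈ S, #(disjointFrom S s) * #S ≤ P := by
    by_contra! hc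
    have h1 : ∑ s ∈ S, P < ∑ s ∈ S, #(disjointFrom S s) * #S := Finset.sum_lt_sum_of_nonempty hS hc
    rw [Finset.sum_const, smul_eq_mul, ← Finset.sum_mul, ← hPsum, mul_comm] at h1
    exact lt_irrefl _ h1
  obtain ⟨i, j⟩ := s
  set R := S.filter fun x => x.1 = i with hR
  set C := S.filter fun x => x.2 = j with hC
  have hM : 0 < #S := hS.card_pos
  -- The extra 1 is because the chosen cell lies in both its row `R` and its column `C`.
  have hcover : #S + 1 ≤ #R + #C + #(disjointFrom S (i, j)) := by
    have h1 : S ⊆ (R ∪ C) ∪ disjointFrom S (i, j) := by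
      intro x hx
      simp only [hR, hC, disjointFrom, Finset.mem_union, Finset.mem_filter, hx, true_and]
      tauto
    have h2 := (Finset.card_le_card h1).trans (Finset.card_union_le _ _)
    have h3 := Finset.card_union_add_card_inter R C
    have h4 : 0 < #(R ∩ C) := Finset.card_pos.2 ⟨(i, j), by simp [hR, hC, hs]⟩
    omega
  -- A cell off row `i` is disjoint from every cell of `R` except possibly the one in its own
  -- column.
  have hrow : ∀ x ∈ S.filter (fun x => x.1 ≠ i), #R ≤ #(disjointFrom S x) + 1 := by
    intro x hx
    rw [Finset.mem_filter] at hx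
    have h1 : R ⊆ disjointFrom S x ∪ {(i, x.2)} := by
      rintro ⟨a, b⟩ hab
      simp only [hR, Finset.mem_filter] at hab
      obtain ⟨hab, rfl⟩ := hab
      simp only [disjointFrom, Finset.mem_union, Finset.mem_filter, hab, true_and,
        Finset.mem_singleton, Prod.mk.injEq]
      have := hx.2.symm
      tauto
    simpa using (Finset.card_le_card h1).trans (Finset.card_union_le _ _)
  have hcol : ∀ x ∈ S.filter (fun x => x.2 ≠ j), #C ≤ #(disjointFrom S x) + 1 := by
    intro x hx
    rw [Finset.mem_filter] at hx
    have h1 : C ⊆ disjointFrom S x ∪ {(x.1, j)} := by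
      rintro ⟨a, b⟩ hab
      simp only [hC, Finset.mem_filter] at hab
      obtain ⟨hab, rfl⟩ := hab
      simp only [disjointFrom, Finset.mem_union, Finset.mem_filter, hab, true_and,
        Finset.mem_singleton, Prod.mk.injEq]
      have := hx.2.symm
      tauto
    simpa using (Finset.card_le_card h1).trans (Finset.card_union_le _ _)
  have hbound : ∀ (T L : Finset (Fin n × Fin n)), T ⊆ S →
      (∀ x ∈ T, #L ≤ #(disjointFrom S x) + 1) → #T * (#L - 1) ≤ P := by
    intro T L hT hx
    rw [hP, hPsum]
    calc #T * (#L - 1) = ∑ x ∈ T, (#L - 1) := by simp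
      _ ≤ ∑ x ∈ T, #(disjointFrom S x) := Finset.sum_le_sum fun x hx' => by
          have := hx x hx'; omega
      _ ≤ _ := Finset.sum_le_sum_of_subset hT
  have hbR := hbound _ R (Finset.filter_subset _ _) hrow
  have hbC := hbound _ C (Finset.filter_subset _ _) hcol
  have hiC : #C ≤ #(S.filter fun x => x.1 ≠ i) + 1 := by
    have h1 : C ⊆ (S.filter fun x => x.1 ≠ i) ∪ {(i, j)} := by
      rintro ⟨a, b⟩ hab
      simp only [hC, Finset.mem_filter] at hab
      obtain ⟨hab, rfl⟩ := hab
      simp only [Finset.mem_union, Finset.mem_filter, hab, true_and, Finset.mem_singleton,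
        Prod.mk.injEq]
      tauto
    simpa using (Finset.card_le_card h1).trans (Finset.card_union_le _ _)
  set o := #(S.filter fun x => x.1 ≠ i) with ho
  set o' := #(S.filter fun x => x.2 ≠ j) with ho'
  have hoM : o + #R = #S := by
    have := Finset.card_filter_add_card_filter_not (s := S) (fun x => x.1 = i)
    rw [ho, hR]; simp only [ne_eq]; omega
  have hoM' : o' + #C = #S := by
    have := Finset.card_filter_add_card_filter_not (s := S) (fun x => x.2 = j)
    rw [ho', hC]; simp only [ne_eq]; omega
  have hq : 100 * #(disjointFrom S (i, j)) ≤ #S := by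
    have : 100 * #(disjointFrom S (i, j)) * #S ≤ #S * #S := by nlinarith
    exact Nat.le_of_mul_le_mul_right this hM
  have hR1 : 1 ≤ #R := Finset.card_pos.2 ⟨(i, j), by simp [hR, hs]⟩
  have hC1 : 1 ≤ #C := Finset.card_pos.2 ⟨(i, j), by simp [hC, hs]⟩
  obtain ⟨r, hr⟩ := Nat.exists_eq_add_of_le' hR1
  obtain ⟨c, hc⟩ := Nat.exists_eq_add_of_le' hC1
  rw [hr, Nat.add_sub_cancel] at hbR
  rw [hc, Nat.add_sub_cancel] at hbC
  -- Column cells other than (i, j) lie off row `i`, so c · r is at most the number of disjoint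
  -- pairs. The smaller of c and r is then at most a tenth of #S, and by the covering bound the
  -- larger is at least a quarter once #S ≥ 2.
  have hcr : 100 * (c * r) ≤ #S ^ 2 := by
    have : c ≤ o := by omega
    nlinarith [Nat.mul_le_mul_right r this]
  rcases Nat.lt_or_ge (#S) 2 with h1 | h2
  · left
    refine ⟨i, ?_⟩
    have : o = 0 := by omega
    rw [← ho, this]; omega
  rcases le_total c r with hle | hle
  · left
    refine ⟨i, ?_⟩
    have h10 : 10 * c ≤ #S := by
      by_contra! hlt
      have h3 : #S ^ 2 < (10 * c) ^ 2 := Nat.pow_lt_pow_left hlt two_ne_zero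
      have h4 : c * c ≤ c * r := Nat.mul_le_mul_left c hle
      have h5 : (10 * c) ^ 2 = 100 * (c * c) := by ring
      linarith
    have h6 : #S ≤ 4 * r := by omega
    calc o * #S ≤ o * (4 * r) := Nat.mul_le_mul_left _ h6
      _ = 4 * (o * r) := by ring
      _ ≤ 4 * P := by linarith
  · right
    refine ⟨j, ?_⟩
    have h10 : 10 * r ≤ #S := by
      by_contra! hlt
      have h3 : #S ^ 2 < (10 * r) ^ 2 := Nat.pow_lt_pow_left hlt two_ne_zero
      have h4 : r * r ≤ r * c := Nat.mul_le_mul_left r hle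
      have h5 : (10 * r) ^ 2 = 100 * (r * r) := by ring
      linarith
    have h6 : #S ≤ 4 * c := by omega
    calc o' * #S ≤ o' * (4 * c) := Nat.mul_le_mul_left _ h6
      _ = 4 * (o' * c) := by ring
      _ ≤ 4 * P := by linarith

/-! ### Clamping to a dictator and estimating the error -/

lemma mul_mean_sum_cosetIndicator (T : Finset (Fin n × Fin n)) :
    (n : ℝ) * mean (fun π => ∑ x ∈ T, cosetIndicator x.1 x.2 π) = #T := by
  have h1 : mean (fun π => ∑ x ∈ T, cosetIndicator x.1 x.2 π)
      = ∑ x ∈ T, mean (fun π : Equiv.Perm (Fin n) => cosetIndicator x.1 x.2 π) := by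
    unfold mean; rw [Finset.expect_sum_comm]
  have h2 : ∀ x : Fin n × Fin n,
      (n : ℝ) * mean (fun π : Equiv.Perm (Fin n) => cosetIndicator x.1 x.2 π) = 1 := fun x => by
    have := mul_mean_apply (fun j => if j = x.2 then (1 : ℝ) else 0) x.1
    simpa [cosetIndicator] using this
  rw [h1, Finset.mul_sum, Finset.sum_congr rfl fun x _ => h2 x]
  simp

lemma sum_cosetIndicator_nonneg (T : Finset (Fin n × Fin n)) (π : Equiv.Perm (Fin n)) :
    0 ≤ ∑ x ∈ T, cosetIndicator x.1 x.2 π :=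
  Finset.sum_nonneg fun x _ => by unfold cosetIndicator; split_ifs <;> norm_num

lemma one_le_sum_cosetIndicator {T : Finset (Fin n × Fin n)} {π : Equiv.Perm (Fin n)}
    (h : ¬ ∀ x ∈ T, π x.1 ≠ x.2) : 1 ≤ ∑ x ∈ T, cosetIndicator x.1 x.2 π := by
  push Not at h
  obtain ⟨x, hx, hπ⟩ := h
  have h1 : cosetIndicator x.1 x.2 π = 1 := by simp [cosetIndicator, hπ]
  rw [← h1]
  exact Finset.single_le_sum (f := fun x : Fin n × Fin n => cosetIndicator x.1 x.2 π)
    (fun y _ => by simp only [cosetIndicator]; split_ifs <;> norm_num) hx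

/-- Round an integer to the nearest element of `{0, 1}`. -/
def clampBool (z : ℤ) : ℝ := if 1 ≤ z then 1 else 0

lemma clampBool_eq (z : ℤ) : clampBool z = 0 ∨ clampBool z = 1 := by
  unfold clampBool; split_ifs <;> simp

lemma abs_sub_clampBool (z : ℤ) : |(z : ℝ) - clampBool z| = distBool z := by
  unfold clampBool distBool
  split_ifs with h
  · have h1 : (1 : ℝ) ≤ z := by exact_mod_cast h
    rw [sub_zero, abs_of_nonneg (by linarith : (0 : ℝ) ≤ z), abs_of_nonneg (by linarith),
      min_eq_right (by linarith)]
  · have h1 : (z : ℝ) ≤ 0 := by exact_mod_cast (by omega : z ≤ 0)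
    rw [sub_zero, abs_of_nonpos h1, abs_of_nonpos (by linarith), min_eq_left (by linarith)]

lemma abs_sub_le_one_add_distBool (x : ℝ) {y : ℝ} (hy : y = 0 ∨ y = 1) :
    |x - y| ≤ 1 + distBool x := by
  have h1 : |x| ≤ |x - 1| + 1 := by simpa using abs_add_le (x - 1) 1
  have h2 : |x - 1| ≤ |x| + 1 := by simpa using abs_sub x 1
  rcases hy with rfl | rfl <;> rcases distBool_eq_or x with h | h <;> rw [h] <;> simp <;> linarith

/-- The distance is itself a nonnegative integer, so for integer-valued functions an L₂ bound is an
L₁ bound without loss of a square root. -/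
lemma distBool_intCast_le_sq (z : ℤ) : distBool (z : ℝ) ≤ distBool (z : ℝ) ^ 2 := by
  have hint : ∀ y : ℤ, |(y : ℝ)| ≤ |(y : ℝ)| ^ 2 := fun y => by
    rcases eq_or_ne y 0 with rfl | hy
    · simp
    · have : (1 : ℝ) ≤ |(y : ℝ)| := by exact_mod_cast Int.one_le_abs hy
      nlinarith
  rcases distBool_eq_or (z : ℝ) with h | h <;> rw [h]
  · exact hint z
  · exact_mod_cast hint (z - 1)

section Clamp

variable {G h : Equiv.Perm (Fin n) → ℤ} {T : Finset (Fin n × Fin n)}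

/-- Off `T` the clamping error is exactly the distance to {0,1}. If some cell of `T` is met, the
error is at most 1 plus that distance, and the number of cells met pays for the 1. -/
lemma sq_sub_clampBool_le (hG : ∀ π, (∀ x ∈ T, π x.1 ≠ x.2) → G π = h π) (π : Equiv.Perm (Fin n)) :
    ((G π : ℝ) - clampBool (h π)) ^ 2
      ≤ 2 * distBool (G π) ^ 2 + 2 * ∑ x ∈ T, cosetIndicator x.1 x.2 π := by
  by_cases hT : ∀ x ∈ T, π x.1 ≠ x.2
  · rw [← hG π hT, ← sq_abs, abs_sub_clampBool]
    nlinarith [sum_cosetIndicator_nonneg T π, sq_nonneg (distBool (G π))]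
  · have h1 := one_le_sum_cosetIndicator hT
    have h2 := abs_sub_le_one_add_distBool (G π) (clampBool_eq (h π))
    rw [← sq_abs]
    nlinarith [abs_nonneg ((G π : ℝ) - clampBool (h π)), sq_nonneg (distBool (G π) - 1)]

lemma abs_sub_clampBool_le (hG : ∀ π, (∀ x ∈ T, π x.1 ≠ x.2) → G π = h π) (π : Equiv.Perm (Fin n)) :
    |(G π : ℝ) - clampBool (h π)|
      ≤ distBool (G π) ^ 2 + ∑ x ∈ T, cosetIndicator x.1 x.2 π := by
  have h0 := distBool_intCast_le_sq (G π)
  by_cases hT : ∀ x ∈ T, π x.1 ≠ x.2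
  · rw [← hG π hT, abs_sub_clampBool]
    linarith [sum_cosetIndicator_nonneg T π]
  · have h1 := one_le_sum_cosetIndicator hT
    have h2 := abs_sub_le_one_add_distBool (G π) (clampBool_eq (h π))
    linarith

lemma mul_mean_sub_clampBool_sq_le (hG : ∀ π, (∀ x ∈ T, π x.1 ≠ x.2) → G π = h π) {η : ℝ}
    (hη : mean (fun π => distBool (G π) ^ 2) ≤ η) :
    (n : ℝ) * mean (fun π => ((G π : ℝ) - clampBool (h π)) ^ 2) ≤ 2 * η * n + 2 * #T := by
  have h1 := mean_mono (sq_sub_clampBool_le hG)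
  rw [mean_add, mean_const_mul, mean_const_mul] at h1
  have h2 := mul_mean_sum_cosetIndicator T
  have h3 : (0 : ℝ) ≤ n := Nat.cast_nonneg n
  nlinarith

end Clamp

lemma sum_eq_apply_of_avoid_row (d : Fin n → Fin n → ℤ) (i : Fin n) (π : Equiv.Perm (Fin n))
    (h : ∀ x ∈ (matSupport d).filter (fun x => x.1 ≠ i), π x.1 ≠ x.2) :
    ∑ x, d x (π x) = d i (π i) := by
  refine Finset.sum_eq_single i (fun x _ hx => ?_) (by simp)
  by_contra hne
  exact h (x, π x) (by simp [matSupport, hne, hx]) rfl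

lemma sum_eq_apply_of_avoid_col (d : Fin n → Fin n → ℤ) (j : Fin n) (π : Equiv.Perm (Fin n))
    (h : ∀ x ∈ (matSupport d).filter (fun x => x.2 ≠ j), π x.1 ≠ x.2) :
    ∑ x, d x (π x) = d (π⁻¹ j) j := by
  rw [Finset.sum_eq_single (π⁻¹ j) (fun x _ hx => ?_) (by simp)]
  · simp
  by_contra hne
  have hx' : π x ≠ j := fun he => hx (by rw [← he]; simp)
  exact h (x, π x) (by simp [matSupport, hne, hx']) rfl

lemma sum_eq_zero_of_avoid (d : Fin n → Fin n → ℤ) (π : Equiv.Perm (Fin n))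
    (h : ∀ x ∈ matSupport d, π x.1 ≠ x.2) : ∑ x, d x (π x) = 0 := by
  refine Finset.sum_eq_zero fun x _ => ?_
  by_contra hne
  exact h (x, π x) (by simp [matSupport, hne]) rfl

lemma mean_sub_sq_le_add (f G g : Equiv.Perm (Fin n) → ℝ) :
    mean (fun π => (f π - g π) ^ 2)
      ≤ 2 * mean (fun π => (f π - G π) ^ 2) + 2 * mean (fun π => (G π - g π) ^ 2) := by
  rw [← mean_const_mul, ← mean_const_mul, ← mean_add]
  exact mean_mono fun π => by nlinarith [sq_nonneg ((f π - G π) - (G π - g π))]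

/-- If `f` is close to an integer-valued function equal to a constant off `T`, and the mean of `f` is
far from `0` and `1`, then `T` is large. -/
lemma mul_le_two_mul_card (hn : 0 < n) {f : Equiv.Perm (Fin n) → ℝ} {G : Equiv.Perm (Fin n) → ℤ}
    {T : Finset (Fin n × Fin n)} {k : ℤ} {ε δ : ℝ}
    (hG : ∀ π, (∀ x ∈ T, π x.1 ≠ x.2) → G π = k)
    (hη : mean (fun π => distBool (G π) ^ 2) ≤ 90000 * ε)
    (hfG : mean (fun π => (f π - G π) ^ 2) ≤ 40000 * ε)
    (hδ : 0 < δ) (hεδ : 10 ^ 16 * ε ≤ δ ^ 2) (h1 : δ ≤ mean f) (h2 : mean f ≤ 1 - δ) :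
    δ * n ≤ 2 * #T := by
  have hn' : (0 : ℝ) < n := by exact_mod_cast hn
  have hT := mul_mean_sum_cosetIndicator T
  set q := mean (fun π => ∑ x ∈ T, cosetIndicator x.1 x.2 π) with hq
  have hpt : ∀ π, |f π - clampBool k| ≤ (δ / 8 + 2 / δ * (f π - G π) ^ 2)
      + (distBool (G π) ^ 2 + ∑ x ∈ T, cosetIndicator x.1 x.2 π) := by
    intro π
    have e1 := abs_sub_clampBool_le hG π
    have e2 := abs_sub_le (f π) (G π) (clampBool k)
    -- AM–GM with weight adapted to δ. With the lower bound δ on the mean distance from the clamped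
    -- constant, the budget is δ ≤ δ/8 + δ/8 + δ/4 + q, leaving q ≥ δ/2.
    have e3 : |f π - G π| ≤ δ / 8 + 2 / δ * (f π - G π) ^ 2 := by
      rw [← sq_abs (f π - G π)]
      set y := |f π - G π|
      have : δ / 8 + 2 / δ * y ^ 2 - y = 2 / δ * (y - δ / 4) ^ 2 := by field_simp; ring
      have : 0 ≤ 2 / δ * (y - δ / 4) ^ 2 := by positivity
      linarith
    linarith
  have hmean := mean_mono hpt
  rw [mean_add, mean_add, mean_add, mean_const, mean_const_mul, ← hq] at hmean
  have hlow : δ ≤ mean (fun π => |f π - clampBool k|) := by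
    rcases clampBool_eq k with hk | hk <;> rw [hk]
    · exact h1.trans (mean_mono fun π => by simpa using le_abs_self (f π))
    · have e : mean (fun π => 1 + (-1) * f π) = 1 - mean f := by
        rw [mean_add, mean_const, mean_const_mul]; ring
      have : mean (fun π => 1 + (-1) * f π) ≤ mean (fun π => |f π - 1|) :=
        mean_mono fun π => by linarith [neg_abs_le (f π - 1)]
      linarith
  have hδ1 : δ ≤ 1 := by linarith
  have hb1 : 2 / δ * mean (fun π => (f π - G π) ^ 2) ≤ δ / 8 := by
    calc 2 / δ * mean (fun π => (f π - G π) ^ 2) ≤ 2 / δ * (δ ^ 2 / 16) := by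
          gcongr; nlinarith
      _ = δ / 8 := by field_simp; norm_num
  have hb2 : 90000 * ε ≤ δ / 4 := by nlinarith
  have hq2 : δ / 2 ≤ q := by linarith
  rw [← hT]
  nlinarith

/-- The main case of the theorem: large `n`. -/
lemma exists_dictator_of_large (hn : 64 ≤ n) {f : Equiv.Perm (Fin n) → ℝ}
    {b : Fin n → Fin n → ℤ} {ε δ : ℝ}
    (hη : mean (fun π => distBool (lin (fun i j => (b i j : ℝ)) π) ^ 2) ≤ 90000 * ε)
    (hfG : mean (fun π => (f π - lin (fun i j => (b i j : ℝ)) π) ^ 2) ≤ 40000 * ε)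
    (hδ : 0 < δ) (hεδ : 10 ^ 16 * ε ≤ δ ^ 2) (h1 : δ ≤ mean f) (h2 : mean f ≤ 1 - δ) :
    ∃ g : Equiv.Perm (Fin n) → ℝ, IsDictator g ∧ IsClose (10 ^ 15 * (ε / δ)) f g := by
  have hδ2 : δ ≤ 1 / 2 := by linarith
  have hε1 : 3072 * (90000 * ε) ≤ 1 := by nlinarith
  have hn' : (0 : ℝ) < n := by exact_mod_cast (by omega : 0 < n)
  have hε0 : 0 ≤ ε := by
    have := (mean_nonneg fun π => sq_nonneg _).trans hη
    linarith
  obtain ⟨d, k, hbd, hP⟩ := exists_normalisation hn hη hε1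
  simp only [lin_intCast] at hη hfG
  set S := matSupport d with hS
  have hM := mul_le_two_mul_card (by omega) (T := S) (k := k)
    (fun π hπ => by rw [hbd, sum_eq_zero_of_avoid d π hπ, add_zero]) hη hfG hδ hεδ h1 h2
  have hM0 : (0 : ℝ) < #S := by nlinarith [mul_pos hδ hn']
  have h100 : 100 * #(disjointPairs S) ≤ #S ^ 2 := by
    have e : (100 : ℝ) * #(disjointPairs S) ≤ #S ^ 2 := by
      have e1 : (δ * n) ^ 2 ≤ (2 * #S : ℝ) ^ 2 := by gcongr
      have e2 : 10 ^ 16 * ε * n ^ 2 ≤ δ ^ 2 * (n : ℝ) ^ 2 := by gcongr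
      have e3 : 0 ≤ ε * (n : ℝ) ^ 2 := by positivity
      nlinarith
    exact_mod_cast e
  have hfinish : ∀ (h : Equiv.Perm (Fin n) → ℤ) (T : Finset (Fin n × Fin n)),
      #T * #S ≤ 4 * #(disjointPairs S) →
      (∀ π, (∀ x ∈ T, π x.1 ≠ x.2) → ∑ i, b i (π i) = h π) →
      IsClose (10 ^ 15 * (ε / δ)) f fun π => clampBool (h π) := by
    intro h T hT hG
    have e1 := mul_mean_sub_clampBool_sq_le hG hη
    have e2 := mean_sub_sq_le_add f (fun π => ((∑ i, b i (π i) : ℤ) : ℝ)) fun π => clampBool (h π)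
    have e3 : (#T : ℝ) * #S ≤ 4 * #(disjointPairs S) := by exact_mod_cast hT
    set D := mean (fun π => (((∑ i, b i (π i) : ℤ) : ℝ) - clampBool (h π)) ^ 2)
    unfold IsClose
    refine e2.trans ?_
    set y := ε / δ with hy
    have hεy : ε = y * δ := by rw [hy]; field_simp
    have hy0 : 0 ≤ y := div_nonneg hε0 hδ.le
    -- The quotient ε/δ arises here: #T ≤ 4 #(disjoint pairs) / #S, with O(ε n²) pairs and #S ≥
    -- δn/2.
    have hT2 : (#T : ℝ) ≤ 72 * 10 ^ 12 * y * n := by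
      have e4 : (#T : ℝ) * (δ * n) ≤ #T * (2 * #S) :=
        mul_le_mul_of_nonneg_left hM (Nat.cast_nonneg _)
      refine le_of_mul_le_mul_right ?_ (mul_pos hδ hn')
      calc (#T : ℝ) * (δ * n) ≤ 8 * #(disjointPairs S) := by linarith
        _ ≤ 8 * (100000000 * (90000 * ε) * n ^ 2) := by linarith
        _ = _ := by rw [hεy]; ring
    have hD : D ≤ 180000 * ε + 144 * 10 ^ 12 * y := by
      refine le_of_mul_le_mul_left ?_ hn'
      nlinarith
    have hεle : ε ≤ y := by rw [hεy]; nlinarith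
    linarith
  rcases exists_line (Finset.card_pos.1 (by exact_mod_cast hM0)) h100 with ⟨i, hi⟩ | ⟨j, hj⟩
  · refine ⟨fun π => clampBool (k + d i (π i)), ⟨fun π => clampBool_eq _, Or.inl ⟨i, fun π σ h => ?_⟩⟩,
      hfinish (fun π => k + d i (π i)) _ hi fun π hπ => ?_⟩
    · simp only [h]
    · rw [hbd, sum_eq_apply_of_avoid_row d i π hπ]
  · refine ⟨fun π => clampBool (k + d (π⁻¹ j) j),
      ⟨fun π => clampBool_eq _, Or.inr ⟨j, fun π σ h => ?_⟩⟩,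
      hfinish (fun π => k + d (π⁻¹ j) j) _ hj fun π hπ => ?_⟩
    · simp only [h]
    · rw [hbd, sum_eq_apply_of_avoid_col d j π hπ]

/-! ### Combining the ranges of `n` -/

/-- Here the function is constant with value in [δ, 1-δ], hence at distance at least δ from {0,1},
which is incompatible with ε ≤ δ²/10¹⁶. -/
lemma not_close_of_le_one (hn : n ≤ 1) {f : Equiv.Perm (Fin n) → ℝ} {ε δ : ℝ}
    (hf : IsCloseToBoolean ε f) (hδ : 0 < δ) (hεδ : 10 ^ 16 * ε ≤ δ ^ 2) (h1 : δ ≤ mean f)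
    (h2 : mean f ≤ 1 - δ) : False := by
  have : Subsingleton (Fin n) := Fin.subsingleton_iff_le_one.2 hn
  have hconst : ∀ π, f π = f 1 := fun π => by rw [Subsingleton.elim π 1]
  have hm : mean f = f 1 := by
    rw [show f = fun _ => f 1 from funext hconst, mean_const]
  unfold IsCloseToBoolean at hf
  simp only [hconst, mean_const] at hf
  rw [hm] at h1 h2
  have h3 : δ ≤ distBool (f 1) := by
    refine le_min ?_ ?_
    · rw [sub_zero]; exact h1.trans (le_abs_self _)
    · have := neg_abs_le (f 1 - 1); linarith
  nlinarith [pow_pos hδ 2]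

lemma exists_dictator {f : Equiv.Perm (Fin n) → ℝ} {ε δ : ℝ} (hlin : IsLinear f)
    (hf : IsCloseToBoolean ε f) (hδ : 0 < δ) (hεδ : 10 ^ 16 * ε ≤ δ ^ 2)
    (hε : (Nat.factorial 64 : ℝ) * (90000 * ε) < 1) (h1 : δ ≤ mean f) (h2 : mean f ≤ 1 - δ) :
    ∃ g : Equiv.Perm (Fin n) → ℝ, IsDictator g ∧ IsClose (10 ^ 15 * (ε / δ)) f g := by
  rcases Nat.lt_or_ge n 2 with hn | hn
  · exact (not_close_of_le_one (by omega) hf hδ hεδ h1 h2).elim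
  have hε0 : 0 ≤ ε := (mean_nonneg fun π => sq_nonneg _).trans hf
  obtain ⟨c, rfl⟩ := hlin.exists_lin
  obtain ⟨b, hb⟩ := exists_int_lin_close hn hf
  have hη : mean (fun π => distBool (lin (fun i j => (b i j : ℝ)) π) ^ 2) ≤ 90000 * ε := by
    have hpt : ∀ π, distBool (lin (fun i j => (b i j : ℝ)) π) ^ 2
        ≤ 2 * (lin c π - lin (fun i j => (b i j : ℝ)) π) ^ 2 + 2 * distBool (lin c π) ^ 2 := by
      intro π
      have := distBool_sq_le (lin (fun i j => (b i j : ℝ)) π) (lin c π)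
      linarith [sub_sq_comm (lin (fun i j => (b i j : ℝ)) π) (lin c π)]
    have h3 := mean_mono hpt
    rw [mean_add, mean_const_mul, mean_const_mul] at h3
    unfold IsCloseToBoolean at hf
    linarith
  rcases Nat.lt_or_ge n 64 with hn2 | hn2
  · refine ⟨_, isDictator_of_mean_lt (b := b) (by omega) ?_, ?_⟩
    · refine lt_of_le_of_lt ?_ hε
      have : (n.factorial : ℝ) ≤ Nat.factorial 64 := by
        exact_mod_cast Nat.factorial_le hn2.le
      exact mul_le_mul this hη (mean_nonneg fun π => sq_nonneg _) (Nat.cast_nonneg _)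
    · refine hb.trans ?_
      have hδ1 : δ ≤ 1 := by linarith
      have : ε ≤ ε / δ := by rw [le_div_iff₀ hδ]; nlinarith
      linarith
  · exact exists_dictator_of_large hn2 hη hb hδ hεδ h1 h2

end SymmetricFKN

end

theorem theorem5 :
    ∃ K : ℝ, 0 < K ∧ ∃ C : ℝ, 0 < C ∧
      ∀ (n : ℕ) (f : Equiv.Perm (Fin n) → ℝ) (ε δ : ℝ),
        SymmetricFKN.IsLinear f →
        SymmetricFKN.IsCloseToBoolean ε f →
        0 < δ →
        K * Real.sqrt ε ≤ δ →
        δ ≤ SymmetricFKN.mean f →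
        SymmetricFKN.mean f ≤ 1 - δ →
        ∃ g : Equiv.Perm (Fin n) → ℝ,
          SymmetricFKN.IsDictator g ∧ SymmetricFKN.IsClose (C * (ε / δ)) f g := by
  have hN : (1 : ℝ) ≤ Nat.factorial 64 := by exact_mod_cast Nat.one_le_iff_ne_zero.2 (Nat.factorial_ne_zero 64)
  -- Squaring 10⁸ gives the 10¹⁶ needed for large `n`; with δ ≤ 1/2, the factorial makes ε small
  -- enough for the finite range below 64.
  refine ⟨10 ^ 8 * Nat.factorial 64, by positivity, 10 ^ 15, by positivity, ?_⟩
  intro n f ε δ hlin hf hδ hK h1 h2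
  have hε0 : 0 ≤ ε := (SymmetricFKN.mean_nonneg fun π => sq_nonneg _).trans hf
  set N : ℝ := (Nat.factorial 64 : ℝ) with hNdef
  have hsq : (10 ^ 8 * N) ^ 2 * ε ≤ δ ^ 2 := by
    calc (10 ^ 8 * N) ^ 2 * ε = (10 ^ 8 * N * Real.sqrt ε) ^ 2 := by
          rw [mul_pow _ (Real.sqrt ε), Real.sq_sqrt hε0]
      _ ≤ δ ^ 2 := by gcongr
  have hNε : N * ε ≤ N ^ 2 * ε := by
    have : N ≤ N ^ 2 := by nlinarith
    gcongr
  have hεN : ε ≤ N * ε := by nlinarith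
  have hδ2 : δ ≤ 1 / 2 := by linarith
  have h3 : (10 ^ 8 * N) ^ 2 * ε = 10 ^ 16 * (N ^ 2 * ε) := by ring
  refine SymmetricFKN.exists_dictator hlin hf hδ ?_ ?_ h1 h2
  · linarith
  · rw [← hNdef]
    nlinarith
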